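/- **Corollary 3 (EXPTIME).** Let $m\in\mathbb N$ and write $m=b k^{2}$ with $b\ge 1$ the least possible positive integer; put $n=bk$. For permutations $p_1,p_2,p_3\in S_m$ let $G(p_1,p_2,p_3)$ be the bipartite graph with $m$ rows and $m$ columns in which row $a$ is joined to the columns $p_1(a),p_2(a),p_3(a)$. Let $Z(m,3)$ be the set of all triples $(p_1,p_2,p_3)$ such that: the $p_i$ are pairwise compatible ($p_i(x)\neq p_{i'}(x)$ for all $x$ and all $i\ne i'$), so that $G(p_1,p_2,p_3)$ is a labeled $(m,3)$ BTU (a $3$-regular bipartite graph); the partition of $m$ between $p_1$ and $p_2$ (the half lengths of the cycles formed by the two perfect matchings) is $n+\dots+n$ ($k$ parts), and the one between $p_2$ and $p_3$ is $(m)$; $p_2=I_m$; and $p_1=k*q$ for some $q\in S_{n}$, where $k*q$ is the block diagonal permutation with $k$ copies of $q$. Let $C_j$ be the permutation whose matrix arises from $I_m$ by moving the last $j$ rows to the top; call $j$ admissible if $\min(m-j,j)>bk$ and $\gcd(j,m)=1$. Consider the enumeration-based search algorithm for a girth maximum $(m,3)$ BTU in $Z(m,3)$, with input $m$ and a range $[\mathit{lo},\mathit{hi})$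 of shifts (a single shift $j$ can be prescribed, or the choice left open): it computes $b$ and $k$; for each admissible $j$ in the range it sets $p_2=I_m$, $p_3=C_j$, runs through all $n!$ leaves $q$ of the symmetric permutation tree of degree $n$, tests whether $p_1=k*q$ gives an element of $Z(m,3)$, computes the girth of $G(p_1,p_2,p_3)$ if so, and keeps a pair $(j,q)$ with the largest girth. This algorithm is in EXPTIME: written as a program for a random access machine (unit cost, addition and truncated subtraction only), there is a polynomial $P$ such that, for every $m$ and every range, it halts after at most $2^{P(m)}$ steps. When it halts it has found $b$ and $k$, and, if the range contains an admissible shift, an admissible $j$ in the range and $q\in S_{n}$ such that $(k*q,I_m,C_j)\in Z(m,3)$ has the largest girth among all $(p_1,p_2,p_3)\in Z(m,3)$ with $p_3=C_{j'}$ for some admissible $j'$ in the range, together with that girth; otherwise it reports that there is no such shift. -/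

import Mathlib

/-! ## A random access machine with structured programs

Registers (indexed by the finite type `V`) hold natural numbers, and memory consists of unbounded
arrays of natural numbers (indexed by the finite type `A`).  Each elementary operation costs one
step.  The only arithmetic is addition and truncated subtraction, so that unit cost is polynomially
related to the cost on a Turing machine. -/

namespace RAM

/-- Contents of all registers and all arrays. -/
structure State (V A : Type) where
  reg : V → ℕ
  arr : A → ℕ → ℕ

/-- Expressions: literals, registers, array reads, sum, truncated difference. -/
inductive Expr (V A : Type) where
  | lit (n : ℕ)
  | reg (x : V)
  | get (a : A) (e : Expr V A)
  | add (e f : Expr V A)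
  | sub (e f : Expr V A)

namespace Expr

variable {V A : Type}

/-- Value of an expression. -/
def eval (s : State V A) : Expr V A → ℕ
  | lit n => n
  | reg x => s.reg x
  | get a e => s.arr a (e.eval s)
  | add e f => e.eval s + f.eval s
  | sub e f => e.eval s - f.eval s

/-- Number of elementary operations in the evaluation of an expression. -/
def cost : Expr V A → ℕ
  | lit _ => 1
  | reg _ => 1
  | get _ e => e.cost + 1
  | add e f => e.cost + f.cost + 1
  | sub e f => e.cost + f.cost + 1

/-! Tests; an expression counts as true when its value is not zero. -/

/-- `e < f` -/
def lt (e f : Expr V A) : Expr V A := sub f e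

/-- `e ≠ f` -/
def ne (e f : Expr V A) : Expr V A := add (sub e f) (sub f e)

/-- `e` is false -/
def not (e : Expr V A) : Expr V A := sub (lit 1) e

/-- `e = f` -/
def eq (e f : Expr V A) : Expr V A := not (ne e f)

/-- both `e` and `f` are true -/
def and (e f : Expr V A) : Expr V A := not (add (not e) (not f))

end Expr

/-- Programs; `loop e c` is `while (e) c`. -/
inductive Cmd (V A : Type) where
  | skip
  | assign (x : V) (e : Expr V A)
  | store (a : A) (i e : Expr V A)
  | seq (c d : Cmd V A)
  | ite (e : Expr V A) (c d : Cmd V A)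
  | loop (e : Expr V A) (c : Cmd V A)

/-- `Exec c s t s'`: the program `c`, started in the state `s`, halts after exactly `t` steps in
the state `s'`. -/
inductive Exec {V A : Type} [DecidableEq V] [DecidableEq A] :
    Cmd V A → State V A → ℕ → State V A → Prop where
  | skip (s : State V A) : Exec Cmd.skip s 1 s
  | assign (x : V) (e : Expr V A) (s : State V A) :
      Exec (Cmd.assign x e) s (e.cost + 1)
        ⟨Function.update s.reg x (e.eval s), s.arr⟩
  | store (a : A) (i e : Expr V A) (s : State V A) :
      Exec (Cmd.store a i e) s (i.cost + e.cost + 1)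
        ⟨s.reg, Function.update s.arr a (Function.update (s.arr a) (i.eval s) (e.eval s))⟩
  | seq {c d : Cmd V A} {s s' s'' : State V A} {t t' : ℕ} :
      Exec c s t s' → Exec d s' t' s'' → Exec (Cmd.seq c d) s (t + t') s''
  | ite_true {e : Expr V A} {c d : Cmd V A} {s s' : State V A} {t : ℕ} :
      e.eval s ≠ 0 → Exec c s t s' → Exec (Cmd.ite e c d) s (e.cost + 1 + t) s'
  | ite_false {e : Expr V A} {c d : Cmd V A} {s s' : State V A} {t : ℕ} :
      e.eval s = 0 → Exec d s t s' → Exec (Cmd.ite e c d) s (e.cost + 1 + t) s'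
  | loop_true {e : Expr V A} {c : Cmd V A} {s s' s'' : State V A} {t t' : ℕ} :
      e.eval s ≠ 0 → Exec c s t s' → Exec (Cmd.loop e c) s' t' s'' →
      Exec (Cmd.loop e c) s (e.cost + 1 + t + t') s''
  | loop_false {e : Expr V A} {c : Cmd V A} {s : State V A} :
      e.eval s = 0 → Exec (Cmd.loop e c) s (e.cost + 1) s

namespace Cmd

variable {V A : Type}

/-- Execute the commands of a list one after the other. -/
def block : List (Cmd V A) → Cmd V A
  | [] => skip
  | [c] => c
  | c :: d :: l => seq c (block (d :: l))

/-- `if e then c` -/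
def when (e : Expr V A) (c : Cmd V A) : Cmd V A := ite e c skip

/-- `for (x = 0; x < e; x++) c` -/
def forLoop (x : V) (e : Expr V A) (c : Cmd V A) : Cmd V A :=
  block [assign x (.lit 0),
    Cmd.loop (.lt (.reg x) e) (block [c, assign x (.add (.reg x) (.lit 1))])]

/-- `z = e * f`, by repeated addition with loop counter `i`. -/
def mul (i z : V) (e f : Expr V A) : Cmd V A :=
  block [assign z (.lit 0), forLoop i f (assign z (.add (.reg z) e))]

end Cmd

/-- The deterministic exponential-time requirement: for some polynomial `p`, on every input `i` the
program `c` halts after at most `2 ^ p (size i)` steps, in a state that is a correct answer. -/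
def InEXPTIME {V A ι : Type} [DecidableEq V] [DecidableEq A] (c : Cmd V A)
    (input : ι → State V A) (size : ι → ℕ) (correct : ι → State V A → Prop) : Prop :=
  ∃ p : Polynomial ℕ, ∀ i, ∃ t s', Exec c (input i) t s' ∧
    t ≤ 2 ^ p.eval (size i) ∧ correct i s'

end RAM

/-! ## Balanced Tanner units -/

namespace BTU

open Equiv

/-- The bipartite graph of a family of permutations: row `a` is joined to column `p i a` for
every `i`. -/
def graph {m r : ℕ} (p : Fin r → Perm (Fin m)) : SimpleGraph (Fin m ⊕ Fin m) :=
  SimpleGraph.fromRel fun u v => ∃ a i, u = Sum.inl a ∧ v = Sum.inr (p i a)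

/-- Compatible permutations: they differ in every position. -/
def Compatible {m : ℕ} (p q : Perm (Fin m)) : Prop := ∀ x, p x ≠ q x

/-- The partition of `m` between two permutations: a part `l` stands for a cycle of length `2 * l`
in the union of the two perfect matchings, i.e. for an `l`-cycle of `q⁻¹ * p`. -/
def partitionBetween {m : ℕ} (p q : Perm (Fin m)) : Multiset ℕ := (q⁻¹ * p).partition.parts

/-- `m = b * k ^ 2` with `b` the smallest possible positive integer. -/
def IsParam (m b k : ℕ) : Prop :=
  0 < b ∧ m = b * k ^ 2 ∧ ∀ b' k', 0 < b' → m = b' * k' ^ 2 → b ≤ b'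

/-- The scaling `k * q` of a permutation `q`: the block diagonal permutation with `k` copies
of `q`, so that `c * n + a` goes to `c * n + q a`. -/
def scale {m k n : ℕ} (h : k * n = m) (q : Perm (Fin n)) : Perm (Fin m) :=
  (finProdFinEquiv.trans (finCongr h)).permCongr ((Equiv.refl (Fin k)).prodCongr q)

/-- The circular permutation `C_j`: the matrix is obtained from the identity matrix by moving the
last `j` rows to the top, so that row `x` has its entry in column `x - j` modulo `m`. -/
def circ (m j : ℕ) : Perm (Fin m) := (finRotate m ^ j)⁻¹

/-- The family `Z(m, 3)`; `p 0`, `p 1`, `p 2` are the three permutations. -/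
def Z (m : ℕ) : Set (Fin 3 → Perm (Fin m)) :=
  {p | Pairwise (fun i i' => Compatible (p i) (p i')) ∧
    ∃ b k, IsParam m b k ∧
      partitionBetween (p 0) (p 1) = Multiset.replicate k (b * k) ∧
      partitionBetween (p 1) (p 2) = {m} ∧
      p 1 = 1 ∧
      ∃ (h : k * (b * k) = m) (q : Perm (Fin (b * k))), p 0 = scale h q}

/-- The shifts `j` allowed for the third permutation `C_j`. -/
def Admissible (m b k j : ℕ) : Prop := b * k < min (m - j) j ∧ Nat.Coprime j m

/-! ## The enumeration based search algorithm for `r = 3` -/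

/-- Registers of the algorithm. -/
inductive Reg where
  | m | lo | hi | b | k | n | sq | ok | j | i | x | y
  | acc | leaf | rem | d | c | label | len
  | base | blk | a | e | off | s | e' | off' | g | best | shift
  deriving DecidableEq

/-- Arrays of the algorithm. -/
inductive Arr where
  | fact | used | q | P | dL | dR | out
  deriving DecidableEq

open RAM RAM.Cmd

/-- Commands of the algorithm. -/
abbrev Prog := Cmd Reg Arr

/-- Expressions of the algorithm. -/
abbrev Ex := Expr Reg Arr

/-- The literal `n`. -/
abbrev nat (n : ℕ) : Ex := .lit n

/-- The contents of the register `z`. -/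
abbrev r (z : Reg) : Ex := .reg z

/-- `b = 1; while ((m / b) ^ (1 / 2) ∉ ℕ) b++; k = (m / b) ^ (1 / 2); n = b * k` -/
def findParams : Prog :=
  block [
    assign .b (nat 1),
    assign .ok (nat 0),
    Cmd.loop (.not (r .ok)) (block [
      assign .k (nat 0),
      assign .n (nat 0),
      assign .sq (nat 0),
      Cmd.loop (.lt (r .sq) (r .m)) (block [
        assign .k (.add (r .k) (nat 1)),
        mul .i .n (r .b) (r .k),
        mul .i .sq (r .n) (r .k)]),
      ite (.eq (r .sq) (r .m))
        (assign .ok (nat 1))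
        (assign .b (.add (r .b) (nat 1)))])]

/-- Set `ok` to `1` if `n < j`, `n < m - j` and `j`, `m` are relatively prime, and to `0`
otherwise. -/
def testShift : Prog :=
  block [
    assign .ok (nat 0),
    when (.and (.lt (r .n) (r .j)) (.lt (.add (r .n) (r .j)) (r .m))) (block [
      assign .x (r .j),
      assign .y (r .m),
      Cmd.loop (.ne (r .x) (r .y)) (
        ite (.lt (r .x) (r .y))
          (assign .y (.sub (r .y) (r .x)))
          (assign .x (.sub (r .x) (r .y)))),
      when (.eq (r .x) (nat 1)) (assign .ok (nat 1))])]

/-- `fact[i] = i!` for `0 ≤ i ≤ n`. -/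
def factorials : Prog :=
  block [
    Cmd.store .fact (nat 0) (nat 1),
    forLoop .d (r .n) (block [
      mul .i .acc (.get .fact (r .d)) (.add (r .d) (nat 1)),
      Cmd.store .fact (.add (r .d) (nat 1)) (r .acc)])]

/-- Walk from the root of the symmetric permutation tree of degree `n` to its leaf with number
`leaf` (leaves are numbered from `0` to `n! - 1` from left to right, labels are `0, …, n - 1`), and
record the labels on the way in `q`.  A node at depth `d + 1` has `(n - 1 - d)!` leaves below. -/
def walkToLeaf : Prog :=
  block [
    assign .rem (r .leaf),
    forLoop .d (r .n) (Cmd.store .used (r .d) (nat 0)),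
    forLoop .d (r .n) (block [
      -- the number `c` of the successor node to enter
      assign .c (nat 0),
      Cmd.loop (.not (.lt (r .rem) (.get .fact (.sub (.sub (r .n) (nat 1)) (r .d))))) (block [
        assign .rem (.sub (r .rem) (.get .fact (.sub (.sub (r .n) (nat 1)) (r .d)))),
        assign .c (.add (r .c) (nat 1))]),
      -- its label: the unused label that is preceded by `c` unused labels
      assign .label (nat 0),
      Cmd.loop (.add (.get .used (r .label)) (r .c)) (block [
        when (.not (.get .used (r .label))) (assign .c (.sub (r .c) (nat 1))),
        assign .label (.add (r .label) (nat 1))]),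
      Cmd.store .q (r .d) (r .label),
      Cmd.store .used (r .label) (nat 1)])]

/-- The length `len` of the cycle of `q` through `0`; the partition between `p₁ = k * q` and
`p₂ = I` is `n + ⋯ + n = m` if and only if `len = n`. -/
def cycleLength : Prog :=
  block [
    assign .x (.get .q (nat 0)),
    assign .len (nat 1),
    Cmd.loop (r .x) (block [
      assign .x (.get .q (r .x)),
      assign .len (.add (r .len) (nat 1))])]

/-- The three permutations `p₁ = k * q`, `p₂ = I`, `p₃ = C_j`, one after the other in `P`. -/
def buildBTU : Prog :=
  block [
    assign .base (nat 0),
    forLoop .blk (r .k) (block [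
      forLoop .x (r .n)
        (Cmd.store .P (.add (r .base) (r .x)) (.add (r .base) (.get .q (r .x)))),
      assign .base (.add (r .base) (r .n))]),
    forLoop .x (r .m) (block [
      Cmd.store .P (.add (r .m) (r .x)) (r .x),
      ite (.lt (r .x) (r .j))
        (Cmd.store .P (.add (.add (r .m) (r .m)) (r .x)) (.sub (.add (r .x) (r .m)) (r .j)))
        (Cmd.store .P (.add (.add (r .m) (r .m)) (r .x)) (.sub (r .x) (r .j)))])]

/-- Breadth first search from row `a` in the graph without the edge that the permutation number
`e` puts in row `a`.  A row or column at distance `t` is marked with `t + 1` (in `dL` or `dR`). -/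
def search : Prog :=
  block [
    forLoop .x (r .m) (block [
      Cmd.store .dL (r .x) (nat 0),
      Cmd.store .dR (r .x) (nat 0)]),
    Cmd.store .dL (r .a) (nat 1),
    forLoop .s (.add (r .m) (r .m)) (
      forLoop .x (r .m) (block [
        assign .off' (nat 0),
        forLoop .e' (nat 3) (block [
          when (.not (.and (.eq (r .x) (r .a)) (.eq (r .e') (r .e)))) (block [
            assign .y (.get .P (.add (r .off') (r .x))),
            when (.and (.eq (.get .dL (r .x)) (.add (r .s) (nat 1))) (.not (.get .dR (r .y))))
              (Cmd.store .dR (r .y) (.add (r .s) (nat 2))),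
            when (.and (.eq (.get .dR (r .y)) (.add (r .s) (nat 1))) (.not (.get .dL (r .x))))
              (Cmd.store .dL (r .x) (.add (r .s) (nat 2)))]),
          assign .off' (.add (r .off') (r .m))])]))]

/-- The girth `g`: the least length of a cycle through an edge, over all edges. -/
def computeGirth : Prog :=
  block [
    assign .g (nat 0),
    forLoop .a (r .m) (block [
      assign .off (nat 0),
      forLoop .e (nat 3) (block [
        search,
        assign .y (.get .dR (.get .P (.add (r .off) (r .a)))),
        when (.and (r .y) (.not (.and (r .g) (.not (.lt (r .y) (r .g))))))
          (assign .g (r .y)),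
        assign .off (.add (r .off) (r .m))])])]

/-- Enumerate all `q` in the symmetric group of degree `n = b * k`, and keep in `out` a `q` for
which the girth is largest, together with the shift `j`. -/
def enumerate : Prog :=
  forLoop .leaf (.get .fact (r .n)) (block [
    walkToLeaf,
    cycleLength,
    when (.eq (r .len) (r .n)) (block [
      buildBTU,
      computeGirth,
      when (.lt (r .best) (r .g)) (block [
        assign .best (r .g),
        assign .shift (r .j),
        forLoop .x (r .n) (Cmd.store .out (r .x) (.get .q (r .x)))])])])

/-- The enumeration based search algorithm for a girth maximum `(m, 3)` BTU in `Z(m, 3)`.  The third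
permutation is `C_j`, where `j` is chosen among the admissible shifts `j` with `lo ≤ j < hi`.  So any
single admissible shift can be prescribed (`lo = j`, `hi = j + 1`), and the choice can be left to
the algorithm (`lo = 0`, `hi = m`). -/
def algorithm : Prog :=
  block [
    findParams,
    factorials,
    assign .best (nat 0),
    assign .j (r .lo),
    Cmd.loop (.and (.lt (r .j) (r .hi)) (.lt (r .j) (r .m))) (block [
      testShift,
      when (r .ok) enumerate,
      assign .j (.add (r .j) (nat 1))])]

/-- An input of the algorithm. -/
structure Input where
  m : ℕ
  lo : ℕ
  hi : ℕ

/-- The initial state: the input is in three registers, everything else is zero. -/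
def Input.state (i : Input) : State Reg Arr where
  reg
    | .m => i.m
    | .lo => i.lo
    | .hi => i.hi
    | _ => 0
  arr _ _ := 0

/-- The shifts that may be chosen on a given input. -/
def Input.shifts (i : Input) (b k : ℕ) : Set ℕ :=
  {j | i.lo ≤ j ∧ j < i.hi ∧ Admissible i.m b k j}

/-- What a final state has to contain: the parameters `b` and `k`; if there is a shift to choose,
then a chosen shift `j` and a permutation `q` such that `k * q`, `I`, `C_j` form a BTU in `Z(m, 3)`
whose girth is the largest among all BTUs in `Z(m, 3)` whose third permutation is `C_j'` for one of
the shifts `j'`, and the value `best` of this girth; if there is no shift to choose, then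
`best = 0`. -/
def Correct (i : Input) (s : State Reg Arr) : Prop :=
  IsParam i.m (s.reg .b) (s.reg .k) ∧
  ((i.shifts (s.reg .b) (s.reg .k)).Nonempty →
    s.reg .shift ∈ i.shifts (s.reg .b) (s.reg .k) ∧
    ∃ p ∈ Z i.m, p 2 = circ i.m (s.reg .shift) ∧
      (∃ (h : s.reg .k * (s.reg .b * s.reg .k) = i.m) (q : Perm (Fin (s.reg .b * s.reg .k))),
        p 0 = scale h q ∧ ∀ a : Fin (s.reg .b * s.reg .k), s.arr .out a = q a) ∧
      (∀ p' ∈ Z i.m, ∀ j ∈ i.shifts (s.reg .b) (s.reg .k), p' 2 = circ i.m j →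
        (graph p').egirth ≤ (graph p).egirth) ∧
      (s.reg .best : ℕ∞) = (graph p).egirth) ∧
  (¬ (i.shifts (s.reg .b) (s.reg .k)).Nonempty → s.reg .best = 0)

end BTU

/-! The running time is separated from the correctness by a weakest precondition calculus that
carries one number `K`: `wp K c Q s` says that `c`, started in `s`, reaches `Q` while every
execution of every loop makes at most `K` iterations. Nested loops multiply their iteration counts,
and the nesting is fixed by the program text, so the time is at most `K ^ c.weight` with an exponent
that does not depend on the input (`exists_exec_of_wp`). No loop of the algorithm needs more
iterations than a constant, a multiple of `m` or `m!` allows, so `K = 2 ^ (m ^ 2 + 4)` suffices and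
the time is `2` to a polynomial in `m`.

Correctness rests on four facts. First, leaf numbers are numbers in the factorial base whose digits
form the Lehmer code of the permutation. Reading off the digits decodes a leaf, hence the numbering
is injective, and by counting it hits every number below `n!`; so the enumeration meets every `q`
exactly once.

Second, for an admissible `j` the members of `Z(m, 3)` with third permutation `C_j` are exactly the
triples `k * q`, `I`, `C_j` with `q` an `n`-cycle (`family_mem_Z`, `eq_family_of_mem_Z`). The
partition condition on `k * q` is visible on the cycle of `q` through `0`. Coprimality makes `C_j`
an `m`-cycle. The inequality on `j` makes `C_j` move every row out of reach of a block of length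
`n`, which gives compatibility.

Third, the girth is the minimum, over the edges `uv`, of one plus the distance from `u` to `v` after
deletion of `uv`. Breadth first search finds these distances, because a marking with the local
properties in `IsMarking` is reproduced phase by phase (`search_spec`). Marks are distances plus
one, so the mark of the far end of the deleted edge is already the length of the cycle.

Fourth, the girth is always finite and positive, since the first two permutations alone put every
row on a cycle. Hence `best = 0` can mean that nothing has been found. A rotation is an `n`-cycle,
so something is found as soon as there is an admissible shift. -/

namespace RAM

/-! ### Weakest preconditions with a bound on loop iterations -/

namespace State

set_option linter.unusedSectionVars false

variable {V A : Type} [DecidableEq V] [DecidableEq A]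

/-- Write `v` into the register `x`. -/
def setReg (s : State V A) (x : V) (v : ℕ) : State V A :=
  ⟨Function.update s.reg x v, s.arr⟩

/-- Write `v` into the cell `i` of the array `a`. -/
def setArr (s : State V A) (a : A) (i v : ℕ) : State V A :=
  ⟨s.reg, Function.update s.arr a (Function.update (s.arr a) i v)⟩

@[simp] theorem reg_setReg (s : State V A) (x y : V) (v : ℕ) :
    (s.setReg x v).reg y = if y = x then v else s.reg y := by
  simp [setReg, Function.update_apply]

@[simp] theorem arr_setReg (s : State V A) (x : V) (v : ℕ) :
    (s.setReg x v).arr = s.arr := rfl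

@[simp] theorem reg_setArr (s : State V A) (a : A) (i v : ℕ) :
    (s.setArr a i v).reg = s.reg := rfl

@[simp] theorem arr_setArr (s : State V A) (a b : A) (i v : ℕ) :
    (s.setArr a i v).arr b = if b = a then Function.update (s.arr a) i v else s.arr b := by
  simp [setArr, Function.update_apply]

end State

namespace Expr

variable {V A : Type} (s : State V A) (e f : Expr V A)

@[simp] theorem eval_lit (n : ℕ) : (lit n : Expr V A).eval s = n := rfl
@[simp] theorem eval_reg (x : V) : (reg x : Expr V A).eval s = s.reg x := rfl
@[simp] theorem eval_get (a : A) : (get a e).eval s = s.arr a (e.eval s) := rfl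
@[simp] theorem eval_add : (add e f).eval s = e.eval s + f.eval s := rfl
@[simp] theorem eval_sub : (sub e f).eval s = e.eval s - f.eval s := rfl

@[simp] theorem eval_lt : (lt e f).eval s = 0 ↔ ¬ e.eval s < f.eval s := by
  simp only [lt, eval_sub]; omega

@[simp] theorem eval_ne : (ne e f).eval s = 0 ↔ e.eval s = f.eval s := by
  simp only [ne, eval_sub, eval_add]; omega

@[simp] theorem eval_not : (not e).eval s = 0 ↔ ¬ e.eval s = 0 := by
  simp only [not, eval_sub, eval_lit]; omega

@[simp] theorem eval_eq : (eq e f).eval s = 0 ↔ ¬ e.eval s = f.eval s := by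
  simp [eq]

@[simp] theorem eval_and : (and e f).eval s = 0 ↔ ¬ (¬ e.eval s = 0 ∧ ¬ f.eval s = 0) := by
  have h : (and e f).eval s = 0 ↔ ¬ ((not e).eval s + (not f).eval s = 0) := by
    rw [and, eval_not, eval_add]
  rw [h, Nat.add_eq_zero_iff, eval_not, eval_not]

end Expr

namespace Cmd

variable {V A : Type}

/-- Exponent of the running time of a program all of whose loops have few iterations. -/
def weight : Cmd V A → ℕ
  | skip => 1
  | assign _ e => e.cost + 1
  | store _ i e => i.cost + e.cost + 1
  | seq c d => c.weight + d.weight + 1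
  | ite e c d => e.cost + 1 + (c.weight + d.weight) + 1
  | loop e c => e.cost + 1 + c.weight + 3

/-- The program may write into the given register. -/
def writes [DecidableEq V] : Cmd V A → V → Bool
  | skip, _ => false
  | assign x _, y => decide (y = x)
  | store _ _ _, _ => false
  | seq c d, y => c.writes y || d.writes y
  | ite _ c d, y => c.writes y || d.writes y
  | loop _ c, y => c.writes y

/-- The program may write into the given array. -/
def stores [DecidableEq A] : Cmd V A → A → Bool
  | skip, _ => false
  | assign _ _, _ => false
  | store a _ _, b => decide (b = a)
  | seq c d, b => c.stores b || d.stores b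
  | ite _ c d, b => c.stores b || d.stores b
  | loop _ c, b => c.stores b

end Cmd

set_option linter.unusedSectionVars false

open Cmd

section

variable {V A : Type} [DecidableEq V] [DecidableEq A]

/-- The states agree outside of what the program `c` may change. -/
structure Frame (c : Cmd V A) (s s' : State V A) : Prop where
  reg : ∀ x, c.writes x = false → s'.reg x = s.reg x
  arr : ∀ a, c.stores a = false → s'.arr a = s.arr a

/-- Precondition of a loop that has at most `N` iterations, where `w` gives the precondition of
its body. -/
def wpLoop (e : Expr V A) (w : (State V A → Prop) → State V A → Prop) (Q : State V A → Prop) :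
    ℕ → State V A → Prop
  | 0, s => e.eval s = 0 ∧ Q s
  | N + 1, s => (e.eval s ≠ 0 → w (wpLoop e w Q N) s) ∧ (e.eval s = 0 → Q s)

/-- Weakest precondition for reaching `Q` with at most `K` iterations in each execution of each
loop. -/
def wp (K : ℕ) : Cmd V A → (State V A → Prop) → State V A → Prop
  | .skip, Q, s => Q s
  | .assign x e, Q, s => Q (s.setReg x (e.eval s))
  | .store a i e, Q, s => Q (s.setArr a (i.eval s) (e.eval s))
  | .seq c d, Q, s => wp K c (wp K d Q) s
  | .ite e c d, Q, s => (e.eval s ≠ 0 → wp K c Q s) ∧ (e.eval s = 0 → wp K d Q s)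
  | .loop e c, Q, s => wpLoop e (wp K c) Q K s

variable {K : ℕ} {c d : Cmd V A} {e : Expr V A} {s : State V A} {Q : State V A → Prop}

@[simp] theorem wp_assign {x : V} : wp K (assign x e) Q s ↔ Q (s.setReg x (e.eval s)) := Iff.rfl
@[simp] theorem wp_store {a : A} {i : Expr V A} :
    wp K (store a i e) Q s ↔ Q (s.setArr a (i.eval s) (e.eval s)) := Iff.rfl
@[simp] theorem wp_seq : wp K (seq c d) Q s ↔ wp K c (wp K d Q) s := Iff.rfl
@[simp] theorem wp_ite : wp K (ite e c d) Q s ↔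
    (¬ e.eval s = 0 → wp K c Q s) ∧ (e.eval s = 0 → wp K d Q s) := Iff.rfl
@[simp] theorem wp_when : wp K (when e c) Q s ↔
    (¬ e.eval s = 0 → wp K c Q s) ∧ (e.eval s = 0 → Q s) := Iff.rfl
@[simp] theorem wp_block_singleton : wp K (block [c]) Q s ↔ wp K c Q s := Iff.rfl
@[simp] theorem wp_block_cons {l : List (Cmd V A)} :
    wp K (block (c :: d :: l)) Q s ↔ wp K c (wp K (block (d :: l)) Q) s := Iff.rfl

theorem wp_mono {Q' : State V A → Prop} (h : wp K c Q s) (hQ : ∀ s, Q s → Q' s) :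
    wp K c Q' s := by
  induction c generalizing Q Q' s with
  | skip => exact hQ _ h
  | assign x e => exact hQ _ h
  | store a i e => exact hQ _ h
  | seq c d hc hd => exact hc h fun s hs => hd hs hQ
  | ite e c d hc hd => exact ⟨fun he => hc (h.1 he) hQ, fun he => hd (h.2 he) hQ⟩
  | loop e c hc =>
    have key : ∀ N s, wpLoop e (wp K c) Q N s → wpLoop e (wp K c) Q' N s := by
      intro N
      induction N with
      | zero => exact fun s h => ⟨h.1, hQ _ h.2⟩
      | succ N ih => exact fun s h => ⟨fun he => hc (h.1 he) ih, fun he => hQ _ (h.2 he)⟩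
    exact key K s h

theorem Frame.refl (c : Cmd V A) (s : State V A) : Frame c s s :=
  ⟨fun _ _ => rfl, fun _ _ => rfl⟩

theorem Frame.trans {s' s'' : State V A} (h : Frame c s s') (h' : Frame c s' s'') :
    Frame c s s'' :=
  ⟨fun x hx => (h'.reg x hx).trans (h.reg x hx), fun a ha => (h'.arr a ha).trans (h.arr a ha)⟩

theorem Frame.mono {s' : State V A} (h : Frame c s s')
    (hw : ∀ x, d.writes x = false → c.writes x = false)
    (hs : ∀ a, d.stores a = false → c.stores a = false) : Frame d s s' :=
  ⟨fun x hx => h.reg x (hw x hx), fun a ha => h.arr a (hs a ha)⟩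

/-- Specifications need to mention only what a program is meant to compute. That all other registers
and arrays survive is read off from the program text, and each such claim is settled by `rfl`. -/
theorem wp_frame (h : wp K c Q s) : wp K c (fun s' => Q s' ∧ Frame c s s') s := by
  induction c generalizing Q s with
  | skip => exact ⟨h, Frame.refl _ _⟩
  | assign x e =>
    refine ⟨h, fun y hy => ?_, fun _ _ => rfl⟩
    have : y ≠ x := by simpa [writes] using hy
    simp [this]
  | store a i e =>
    refine ⟨h, fun _ _ => rfl, fun b hb => ?_⟩
    have : b ≠ a := by simpa [stores] using hb
    simp [this]
  | seq c d hc hd =>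
    refine wp_seq.2 (wp_mono (hc (wp_seq.1 h)) fun s₁ hs₁ =>
      wp_mono (hd hs₁.1) fun s₂ hs₂ => ⟨hs₂.1, ?_⟩)
    exact (hs₁.2.mono (fun x hx => by simp_all [writes]) fun a ha => by simp_all [stores]).trans
      (hs₂.2.mono (fun x hx => by simp_all [writes]) fun a ha => by simp_all [stores])
  | ite e c d hc hd =>
    refine ⟨fun he => wp_mono (hc (h.1 he)) fun s₁ hs₁ => ⟨hs₁.1, hs₁.2.mono ?_ ?_⟩,
      fun he => wp_mono (hd (h.2 he)) fun s₁ hs₁ => ⟨hs₁.1, hs₁.2.mono ?_ ?_⟩⟩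
    all_goals intro x hx; simp_all [writes, stores]
  | loop e c hc =>
    have key : ∀ N s, wpLoop e (wp K c) Q N s →
        wpLoop e (wp K c) (fun s' => Q s' ∧ Frame (loop e c) s s') N s := by
      intro N
      induction N with
      | zero => exact fun s h => ⟨h.1, h.2, Frame.refl _ _⟩
      | succ N ih =>
        refine fun s h => ⟨fun he => wp_mono (hc (h.1 he)) fun s₁ hs₁ => ?_,
          fun he => ⟨h.2 he, Frame.refl _ _⟩⟩
        have hF : Frame (loop e c) s s₁ := hs₁.2.mono (fun _ hx => hx) fun _ ha => ha
        -- The induction hypothesis compares final states with `s₁`, the state after one pass;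
        -- composing with the frame of that pass compares them with `s`.
        have key : ∀ N s₂, wpLoop e (wp K c) (fun s' => Q s' ∧ Frame (loop e c) s₁ s') N s₂ →
            wpLoop e (wp K c) (fun s' => Q s' ∧ Frame (loop e c) s s') N s₂ := by
          intro N
          induction N with
          | zero => exact fun s h => ⟨h.1, h.2.1, hF.trans h.2.2⟩
          | succ N ih =>
            exact fun s h => ⟨fun he => wp_mono (h.1 he) ih,
              fun he => ⟨(h.2 he).1, hF.trans (h.2 he).2⟩⟩
        exact key N s₁ (ih s₁ hs₁.1)
    exact key K s h

theorem le_two_pow_of_le {K n : ℕ} (hK : 2 ≤ K) : n ≤ K ^ n :=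
  Nat.lt_two_pow_self.le.trans (Nat.pow_le_pow_left hK n)

theorem pow_add_pow_le {K : ℕ} (hK : 2 ≤ K) (a b : ℕ) : K ^ a + K ^ b ≤ K ^ (a + b + 1) := by
  have h1 : K ^ a ≤ K ^ (a + b) := Nat.pow_le_pow_right (by omega) (by omega)
  have h2 : K ^ b ≤ K ^ (a + b) := Nat.pow_le_pow_right (by omega) (by omega)
  have h3 : K ^ (a + b) * 2 ≤ K ^ (a + b) * K := Nat.mul_le_mul_left _ hK
  rw [pow_succ]
  omega

/-- For `K ≥ 2` a sum of two powers of `K` is at most the power whose exponent is the sum of the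
exponents plus one. So sequencing and branching raise the exponent only by constants, and a loop by
a constant beyond the weight of its body. -/
theorem exists_exec_of_wp (hK : 2 ≤ K) (h : wp K c Q s) :
    ∃ t s', Exec c s t s' ∧ t ≤ K ^ c.weight ∧ Q s' := by
  induction c generalizing Q s with
  | skip => exact ⟨_, _, Exec.skip s, Nat.one_le_pow _ _ (by omega), h⟩
  | assign x e => exact ⟨_, _, Exec.assign x e s, le_two_pow_of_le hK, h⟩
  | store a i e => exact ⟨_, _, Exec.store a i e s, le_two_pow_of_le hK, h⟩
  | seq c d hc hd =>
    obtain ⟨t, s', h1, h2, h3⟩ := hc h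
    obtain ⟨t', s'', h1', h2', h3'⟩ := hd h3
    exact ⟨_, _, h1.seq h1', (Nat.add_le_add h2 h2').trans (pow_add_pow_le hK _ _), h3'⟩
  | ite e c d hc hd =>
    have aux : ∀ t, t ≤ K ^ (c.weight + d.weight) →
        e.cost + 1 + t ≤ K ^ (e.cost + 1 + (c.weight + d.weight) + 1) := fun t ht =>
      (Nat.add_le_add (le_two_pow_of_le hK) ht).trans (pow_add_pow_le hK _ _)
    by_cases he : e.eval s = 0
    · obtain ⟨t, s', h1, h2, h3⟩ := hd (h.2 he)
      exact ⟨_, _, Exec.ite_false he h1,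
        aux t (h2.trans (Nat.pow_le_pow_right (by omega) (by omega))), h3⟩
    · obtain ⟨t, s', h1, h2, h3⟩ := hc (h.1 he)
      exact ⟨_, _, Exec.ite_true he h1,
        aux t (h2.trans (Nat.pow_le_pow_right (by omega) (by omega))), h3⟩
  | loop e c hc =>
    set X := K ^ (e.cost + 1 + c.weight + 1) with hX
    have hX1 : e.cost + 1 + K ^ c.weight ≤ X :=
      (Nat.add_le_add_right (le_two_pow_of_le hK) _).trans (pow_add_pow_le hK _ _)
    have key : ∀ N s, wpLoop e (wp K c) Q N s →
        ∃ t s', Exec (loop e c) s t s' ∧ t ≤ (N + 1) * X ∧ Q s' := by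
      intro N
      induction N with
      | zero => exact fun s h => ⟨_, _, Exec.loop_false h.1, by have := Nat.zero_le (K ^ c.weight); omega, h.2⟩
      | succ N ih =>
        intro s h
        by_cases he : e.eval s = 0
        · exact ⟨_, _, Exec.loop_false he, by nlinarith [Nat.zero_le (K ^ c.weight), Nat.zero_le (N * X)], h.2 he⟩
        · obtain ⟨t, s', h1, h2, h3⟩ := hc (h.1 he)
          obtain ⟨t', s'', h1', h2', h3'⟩ := ih s' h3
          exact ⟨_, _, Exec.loop_true he h1 h1', by nlinarith, h3'⟩
    obtain ⟨t, s', h1, h2, h3⟩ := key K s h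
    refine ⟨t, s', h1, h2.trans ?_, h3⟩
    -- At most `K` passes and the final failing test cost at most `K + 1` times `X`. Two of the
    -- three extra units in the weight of a loop pay for this factor, and the third is already in
    -- `X`.
    have h4 : (K + 1) ≤ K * K := by nlinarith
    calc (K + 1) * X ≤ K * K * X := Nat.mul_le_mul_right _ h4
      _ = K ^ (loop e c).weight := by rw [hX, weight]; ring

theorem wp_of_spec {Q' : State V A → Prop} (h : wp K c Q s)
    (post : ∀ s', Q s' → Frame c s s' → Q' s') : wp K c Q' s :=
  wp_mono (wp_frame h) fun s' hs' => post s' hs'.1 hs'.2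

/-- Programs are deterministic, so two postconditions proved separately hold of the same final
state. -/
theorem wp_and {Q' : State V A → Prop} (h : wp K c Q s) (h' : wp K c Q' s) :
    wp K c (fun s' => Q s' ∧ Q' s') s := by
  induction c generalizing Q Q' s with
  | skip => exact ⟨h, h'⟩
  | assign x e => exact ⟨h, h'⟩
  | store a i e => exact ⟨h, h'⟩
  | seq c d hc hd => exact wp_seq.2 (wp_mono (hc (wp_seq.1 h) (wp_seq.1 h')) fun s hs => hd hs.1 hs.2)
  | ite e c d hc hd =>
    exact ⟨fun he => hc (h.1 he) (h'.1 he), fun he => hd (h.2 he) (h'.2 he)⟩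
  | loop e c hc =>
    have key : ∀ N s, wpLoop e (wp K c) Q N s → wpLoop e (wp K c) Q' N s →
        wpLoop e (wp K c) (fun s' => Q s' ∧ Q' s') N s := by
      intro N
      induction N with
      | zero => exact fun s h h' => ⟨h.1, h.2, h'.2⟩
      | succ N ih =>
        exact fun s h h' => ⟨fun he => wp_mono (hc (h.1 he) (h'.1 he)) fun s hs => ih s hs.1 hs.2,
          fun he => ⟨h.2 he, h'.2 he⟩⟩
    exact key K s h h'

theorem exists_of_wp (hK : 2 ≤ K) (h : wp K c Q s) : ∃ s', Q s' := by
  obtain ⟨-, s', -, -, hs'⟩ := exists_exec_of_wp hK h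
  exact ⟨s', hs'⟩

/-- Rule for loops with a variant. -/
theorem wp_loop (I : State V A → Prop) (μ : State V A → ℕ) (hI : I s) (hμ : μ s < K)
    (step : ∀ s', I s' → ¬ e.eval s' = 0 → Frame c s s' →
      wp K c (fun s'' => I s'' ∧ μ s'' < μ s') s')
    (post : ∀ s', I s' → e.eval s' = 0 → Frame c s s' → Q s') :
    wp K (loop e c) Q s := by
  -- The variant drops at each pass, so a budget of `N` iterations larger than the variant cannot
  -- run out.
  have key : ∀ N s', I s' → Frame c s s' → μ s' < N → wpLoop e (wp K c) Q N s' := by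
    intro N
    induction N with
    | zero => exact fun s' _ _ h => absurd h (Nat.not_lt_zero _)
    | succ N ih =>
      exact fun s' hI hF hμ => ⟨fun he => wp_mono (wp_frame (step s' hI he hF))
        fun s'' h => ih s'' h.1.1 (hF.trans h.2) (by omega), fun he => post s' hI he hF⟩
  exact key K s hI (Frame.refl _ _) hμ

/-- Rule for `for` loops. -/
theorem wp_forLoop {x : V} (N : ℕ) (I : ℕ → State V A → Prop) (hN : N < K)
    (hx : c.writes x = false) (h0 : I 0 (s.setReg x 0))
    (he : ∀ s', Frame (forLoop x e c) s s' → e.eval s' = N)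
    (step : ∀ i s', i < N → s'.reg x = i → I i s' → Frame (forLoop x e c) s s' →
      wp K c (fun s'' => I (i + 1) (s''.setReg x (i + 1))) s')
    (post : ∀ s', s'.reg x = N → I N s' → Frame (forLoop x e c) s s' → Q s') :
    wp K (forLoop x e c) Q s := by
  have hF0 : Frame (forLoop x e c) s (s.setReg x 0) := by
    refine ⟨fun y hy => ?_, fun _ _ => rfl⟩
    have : y ≠ x := by
      rintro rfl
      simp [forLoop, block, writes] at hy
    simp [this]
  have hm : ∀ {s'}, Frame (block [c, assign x (.add (.reg x) (.lit 1))]) (s.setReg x 0) s' →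
      Frame (forLoop x e c) s s' := fun h => hF0.trans (h.mono
        (fun y hy => by simp_all [forLoop, block, writes])
        fun a ha => by simp_all [forLoop, block, stores])
  refine wp_loop (s := s.setReg x 0) (fun s' => s'.reg x ≤ N ∧ I (s'.reg x) s')
    (fun s' => N - s'.reg x) ⟨by simp, by simpa using h0⟩ (by simpa using hN) ?_ ?_
  · intro s' hI hlt hF
    simp only [Expr.eval_lt, he _ (hm hF), Expr.eval_reg, not_not] at hlt
    rw [wp_block_cons]
    refine wp_mono (wp_frame (step _ s' hlt rfl hI.2 (hm hF))) fun s'' h => ?_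
    have hx' := h.2.reg x hx
    simp only [wp_block_singleton, wp_assign, Expr.eval_add, Expr.eval_reg, Expr.eval_lit, hx',
      State.reg_setReg, if_true]
    exact ⟨⟨by omega, h.1⟩, by omega⟩
  · intro s' hI hlt hF
    simp only [Expr.eval_lt, he _ (hm hF), Expr.eval_reg] at hlt
    have : s'.reg x = N := by omega
    exact post s' this (this ▸ hI.2) (hm hF)

/-- Multiplication by repeated addition. -/
theorem wp_mul {i z : V} {f : Expr V A} (a N : ℕ) (hN : N < K) (hiz : i ≠ z)
    (hf : ∀ s', Frame (mul i z e f) s s' → f.eval s' = N)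
    (he : ∀ s', Frame (mul i z e f) s s' → e.eval s' = a)
    (post : ∀ s', s'.reg z = a * N → Frame (mul i z e f) s s' → Q s') :
    wp K (mul i z e f) Q s := by
  have h0 : Frame (mul i z e f) s (s.setReg z 0) := by
    refine ⟨fun y hy => ?_, fun _ _ => rfl⟩
    have : y ≠ z := by
      rintro rfl
      simp [mul, block, writes] at hy
    simp [this]
  have hm : ∀ {s'}, Frame (forLoop i f (assign z (.add (.reg z) e))) (s.setReg z 0) s' →
      Frame (mul i z e f) s s' := fun h => h0.trans (h.mono
        (fun y hy => by simp_all [mul, forLoop, block, writes])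
        fun a ha => by simp_all [mul, forLoop, block, stores])
  refine wp_forLoop (s := s.setReg z 0) N (fun t s' => s'.reg z = a * t) hN
    (by simpa [writes] using hiz) (by simp [hiz.symm]) (fun s' hF => hf s' (hm hF)) ?_ ?_
  · intro t s' ht hi hI hF
    simp only [wp_assign, Expr.eval_add, Expr.eval_reg, he s' (hm hF), hI, State.reg_setReg,
      hiz.symm, if_false, if_true]
    ring
  · exact fun s' _ hI hF => post s' hI (hm hF)

end

end RAM

/-! ### Parameters, shifts and factorials -/

namespace BTU

open Equiv RAM RAM.Cmd

variable {K : ℕ} {s : State Reg Arr}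

theorem findParams_spec {m : ℕ} (hK : m + 2 < K) (hm : s.reg .m = m) :
    wp K findParams (fun s' => IsParam m (s'.reg .b) (s'.reg .k) ∧
      s'.reg .n = s'.reg .b * s'.reg .k) s := by
  simp only [findParams, wp_block_cons, wp_block_singleton, wp_assign]
  -- The search for `b` ends by `b = m`, `k = 1`, and for `m = 0` by `b = 1`, `k = 0`; hence the
  -- bound `max m 1`. The variant falls to `0` when `ok` is set, because `b` does not move in that
  -- pass.
  refine wp_loop (fun s' => s'.reg .m = m ∧ 0 < s'.reg .b ∧ s'.reg .b ≤ max m 1 ∧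
      (∀ b' < s'.reg .b, 0 < b' → ∀ k', m ≠ b' * k' ^ 2) ∧
      (s'.reg .ok ≠ 0 → m = s'.reg .b * s'.reg .k ^ 2 ∧ s'.reg .n = s'.reg .b * s'.reg .k))
    (fun s' => if s'.reg .ok = 0 then m + 2 - s'.reg .b else 0) ?_ ?_ ?_ ?_
  · simp only [State.reg_setReg, hm]
    simp
  · simp
    omega
  · rintro s₁ ⟨hm₁, hb₁, hbm, hmin, -⟩ he -
    simp only [Expr.eval_not, Expr.eval_reg, not_not] at he
    simp only [wp_block_cons, wp_assign]
    generalize hb : s₁.reg .b = b at *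
    refine wp_loop (fun s' => s'.reg .m = m ∧ s'.reg .b = b ∧ s'.reg .ok = 0 ∧
        s'.reg .n = b * s'.reg .k ∧ s'.reg .sq = b * s'.reg .k ^ 2 ∧
        ∀ k' < s'.reg .k, b * k' ^ 2 < m)
      (fun s' => m - s'.reg .sq) ?_ ?_ ?_ ?_
    · simp [hm₁, hb, he]
    · simp
      omega
    · rintro s₂ ⟨h1, h2, h3, h4, h5, h6⟩ he₂ -
      simp only [Expr.eval_lt, Expr.eval_reg, not_not, h1] at he₂
      generalize hk : s₂.reg .k = k at *
      have hkm : k < m := by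
        by_contra h
        have : k * 1 ≤ k ^ 2 := by
          rw [pow_two]
          rcases Nat.eq_zero_or_pos k with h0 | h0
          · simp [h0]
          · exact Nat.mul_le_mul_left _ h0
        nlinarith
      rw [wp_block_cons, wp_assign, wp_block_cons]
      refine wp_mul b (k + 1) (by omega) (by decide) ?_ ?_ ?_
      · intro s' hF
        simp [hF.reg .k rfl, hk]
      · intro s' hF
        simp [hF.reg .b rfl, h2]
      intro s₃ hn₃ hF₃
      rw [wp_block_singleton]
      have hk₃ : s₃.reg .k = k + 1 := by simp [hF₃.reg .k rfl, hk]
      refine wp_mul (b * (k + 1)) (k + 1) (by omega) (by decide) ?_ ?_ ?_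
      · intro s' hF
        simp [hF.reg .k rfl, hk₃]
      · intro s' hF
        simp [hF.reg .n rfl, hn₃]
      intro s₄ hsq₄ hF₄
      have hsq : s₂.reg .sq < s₄.reg .sq := by
        rw [hsq₄, h5]
        nlinarith
      refine ⟨⟨?_, ?_, ?_, ?_, ?_, ?_⟩, ?_⟩
      · simp [hF₄.reg .m rfl, hF₃.reg .m rfl, h1]
      · simp [hF₄.reg .b rfl, hF₃.reg .b rfl, h2]
      · simp [hF₄.reg .ok rfl, hF₃.reg .ok rfl, h3]
      · rw [hF₄.reg .n rfl, hn₃, hF₄.reg .k rfl, hk₃]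
      · rw [hsq₄, hF₄.reg .k rfl, hk₃]
        ring
      · rw [hF₄.reg .k rfl, hk₃]
        intro k' hk'
        rcases Nat.lt_succ_iff_lt_or_eq.1 hk' with h | rfl
        · exact h6 _ h
        · rwa [← h5]
      · omega
    · rintro s₂ ⟨h1, h2, h3, h4, h5, h6⟩ he₂ -
      simp only [Expr.eval_lt, Expr.eval_reg, h1, not_lt] at he₂
      rw [wp_block_singleton, wp_ite, wp_assign, wp_assign]
      simp only [Expr.eval_eq, Expr.eval_reg, h1, not_not]
      constructor
      · intro hsq
        have hb' : b ≤ max m 1 := hbm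
        simp [h1, h2, h4, ← h5, hsq, hb₁, he]
        exact ⟨⟨by omega, hmin⟩, by omega⟩
      · intro hsq
        -- The inner loop stops at the first `k` with `b * k ^ 2 ≥ m`. Smaller values give less than
        -- `m`, and this one and larger ones give more.
        have hno : ∀ k', m ≠ b * k' ^ 2 := by
          intro k' hk'
          rcases lt_or_ge k' (s₂.reg .k) with h | h
          · have := h6 _ h
            omega
          · have : b * s₂.reg .k ^ 2 ≤ b * k' ^ 2 :=
              Nat.mul_le_mul_left _ (Nat.pow_le_pow_left h 2)
            omega
        -- The values `k' = 1` and `k' = 0` exclude `b = m` and `m = 0`, so `b + 1` still respects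
        -- the bound.
        have hbm' : b ≠ m := fun h => hno 1 (by simp [h])
        have hm0 : m ≠ 0 := fun h => hno 0 (by simp [h])
        simp [h1, h2, h3, he]
        refine ⟨⟨by omega, fun b' hb' hb0 k' => ?_⟩, by omega⟩
        rcases Nat.lt_or_eq_of_le hb' with h | rfl
        · exact hmin _ h hb0 k'
        · exact hno k'
  · rintro s' ⟨-, h1, -, h2, h3⟩ he -
    simp only [Expr.eval_not, Expr.eval_reg] at he
    refine ⟨⟨h1, (h3 he).1, fun b' k' hb' hk' => ?_⟩, (h3 he).2⟩
    by_contra h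
    exact h2 b' (by omega) hb' k' hk'

/-- Euclid's algorithm by subtraction keeps the greatest common divisor and shrinks `x + y`, which
starts below `2 * m`. -/
theorem testShift_spec {m n j : ℕ} (hK : 2 * m < K) (hm : s.reg .m = m) (hn : s.reg .n = n)
    (hj : s.reg .j = j) :
    wp K testShift (fun s' => s'.reg .ok ≠ 0 ↔ n < min (m - j) j ∧ Nat.Coprime j m) s := by
  simp only [testShift, wp_block_cons, wp_block_singleton, wp_assign, wp_when]
  simp only [Expr.eval_and, Expr.eval_lt, Expr.eval_add, Expr.eval_reg, Expr.eval_lit,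
    State.reg_setReg, reduceCtorEq, if_false, if_true, hm, hn, hj, not_not]
  refine ⟨fun h => ?_, fun h => ?_⟩
  · refine wp_loop (fun s' => 0 < s'.reg .x ∧ 0 < s'.reg .y ∧ s'.reg .ok = 0 ∧
      (s'.reg .x).gcd (s'.reg .y) = j.gcd m) (fun s' => s'.reg .x + s'.reg .y) ?_ ?_ ?_ ?_
    · simp
      omega
    · simp
      omega
    · rintro s₁ ⟨h1, h2, h3, h4⟩ he -
      simp only [Expr.eval_ne, Expr.eval_reg] at he
      simp [h3]
      refine ⟨fun hlt => ⟨⟨h1, hlt, ?_⟩, by omega⟩, fun hle => ⟨⟨by omega, h2, ?_⟩, by omega⟩⟩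
      · rw [Nat.gcd_sub_self_right hlt.le, h4]
      · rw [Nat.gcd_sub_self_left hle, h4]
    · rintro s₁ ⟨h1, h2, h3, h4⟩ he -
      simp only [Expr.eval_ne, Expr.eval_reg] at he
      rw [← he, Nat.gcd_self] at h4
      simp [h3, Nat.Coprime, ← h4]
      omega
  · simp
    omega

theorem factorials_spec {n : ℕ} (hK : n < K) (hn : s.reg .n = n) :
    wp K factorials (fun s' => ∀ i ≤ n, s'.arr .fact i = i.factorial) s := by
  simp only [factorials, wp_block_cons, wp_block_singleton, wp_store]
  refine wp_forLoop n (fun d s' => ∀ i ≤ d, s'.arr .fact i = i.factorial) hK rfl ?_ ?_ ?_ ?_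
  · simp
  · intro s' hF
    simp [hF.reg .n rfl, hn]
  · intro d s₁ hd hd₁ hI hF
    rw [wp_block_cons]
    refine wp_mul d.factorial (d + 1) (by omega) (by decide) ?_ ?_ ?_
    · intro s' hF
      simp [hF.reg .d rfl, hd₁]
    · intro s' hF
      simp [hF.reg .d rfl, hd₁, hF.arr .fact rfl, hI]
    · intro s₂ hacc hF₂
      simp [hF₂.reg .d rfl, hd₁, hF₂.arr .fact rfl, hacc, Function.update_apply]
      intro i hi
      split_ifs with h
      · rw [h, Nat.factorial_succ, mul_comm]
      · exact hI i (by omega)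
  · exact fun s' _ hI _ => hI

/-! ### Leaves of the symmetric permutation tree and Lehmer codes -/

/-- The labels in `[l, f d)` that `f` does not take before `d`. -/
def unusedBelow (f : ℕ → ℕ) (d l : ℕ) : Finset ℕ :=
  {x ∈ Finset.Ico l (f d) | ∀ i < d, f i ≠ x}

/-- The number, among the leaves below the node of `f` at depth `d`, of the leaf of `f`. -/
def leafBelow (f : ℕ → ℕ) (n d : ℕ) : ℕ :=
  ∑ i ∈ Finset.Ico d n, (unusedBelow f i 0).card * (n - 1 - i).factorial

theorem leafBelow_of_lt (f : ℕ → ℕ) {n d : ℕ} (h : d < n) : leafBelow f n d =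
    (unusedBelow f d 0).card * (n - 1 - d).factorial + leafBelow f n (d + 1) :=
  Finset.sum_eq_sum_Ico_succ_bot h _

/-- The counted labels and the `d + 1` values `f 0, …, f d` are distinct numbers below `n`. This is
the bound on a digit in the factorial base. -/
theorem card_unusedBelow_lt {f : ℕ → ℕ} {n d : ℕ} (h : d < n)
    (hf : Set.MapsTo f (Set.Iio n) (Set.Iio n)) (hinj : Set.InjOn f (Set.Iio n)) :
    (unusedBelow f d 0).card + d < n := by
  have h1 : Disjoint (unusedBelow f d 0) ((Finset.range (d + 1)).image f) := by
    rw [Finset.disjoint_left]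
    intro x hx hx'
    simp only [unusedBelow, Finset.mem_filter, Finset.mem_Ico] at hx
    simp only [Finset.mem_image, Finset.mem_range] at hx'
    obtain ⟨i, hi, rfl⟩ := hx'
    rcases Nat.lt_succ_iff_lt_or_eq.1 hi with h | rfl
    · exact hx.2 i h rfl
    · omega
  have h2 : ((Finset.range (d + 1)).image f).card = d + 1 := by
    rw [Finset.card_image_of_injOn, Finset.card_range]
    intro i hi j hj hij
    simp only [Finset.coe_range, Set.mem_Iio] at hi hj
    exact hinj (show i < n by omega) (show j < n by omega) hij
  have h3 : unusedBelow f d 0 ∪ (Finset.range (d + 1)).image f ⊆ Finset.range n := by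
    intro x hx
    simp only [unusedBelow, Finset.mem_union, Finset.mem_filter, Finset.mem_Ico,
      Finset.mem_image, Finset.mem_range] at hx ⊢
    rcases hx with hx | ⟨i, hi, rfl⟩
    · exact lt_trans hx.1.2 (hf (show d < n from h))
    · exact hf (show i < n by omega)
  have := Finset.card_le_card h3
  rw [Finset.card_union_of_disjoint h1, h2, Finset.card_range] at this
  omega

/-- The digit at depth `d` is at most `n - 1 - d` and the remaining digits contribute less than `(n
- 1 - d)!`, so together they stay below `(n - d)!`. -/
theorem leafBelow_lt {f : ℕ → ℕ} {n : ℕ} (hf : Set.MapsTo f (Set.Iio n) (Set.Iio n))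
    (hinj : Set.InjOn f (Set.Iio n)) {d : ℕ} (h : d ≤ n) :
    leafBelow f n d < (n - d).factorial := by
  induction h using Nat.decreasingInduction with
  | self => simp [leafBelow]
  | of_succ d hd ih =>
    rw [leafBelow_of_lt f hd]
    have h1 := card_unusedBelow_lt hd hf hinj
    have h2 : n - d = n - 1 - d + 1 := by omega
    have h3 : n - (d + 1) = n - 1 - d := by omega
    rw [h3] at ih
    rw [h2, Nat.factorial_succ]
    have h4 : (unusedBelow f d 0).card ≤ n - 1 - d := by omega
    nlinarith [Nat.mul_le_mul_right (n - 1 - d).factorial h4]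

/-- This is one step of the scan for the label: passing `l` uses up one count exactly when `l` is
unused. -/
theorem unusedBelow_of_lt {f : ℕ → ℕ} {d l : ℕ} (hl : l < f d) : unusedBelow f d l =
    if ∃ i < d, f i = l then unusedBelow f d (l + 1) else insert l (unusedBelow f d (l + 1)) := by
  ext x
  split_ifs with h
  · simp only [unusedBelow, Finset.mem_filter, Finset.mem_Ico]
    obtain ⟨i, hi, rfl⟩ := h
    refine ⟨fun hx => ⟨⟨?_, hx.1.2⟩, hx.2⟩, fun hx => ⟨⟨by omega, hx.1.2⟩, hx.2⟩⟩
    have := hx.2 i hi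
    omega
  · simp only [unusedBelow, Finset.mem_insert, Finset.mem_filter, Finset.mem_Ico]
    push Not at h
    refine ⟨fun hx => ?_, ?_⟩
    · rcases eq_or_ne x l with h | h
      · exact Or.inl h
      · exact Or.inr ⟨⟨by omega, hx.1.2⟩, hx.2⟩
    · rintro (rfl | hx)
      · exact ⟨⟨le_rfl, hl⟩, h⟩
      · exact ⟨⟨by omega, hx.1.2⟩, hx.2⟩

/-- At each depth, division of the remainder by `(n - 1 - d)!` yields the next Lehmer digit, because
the lower digits sum to less than the divisor. The digit then determines the label by counting
unused labels from the left. -/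
theorem walkToLeaf_spec {f : ℕ → ℕ} {n : ℕ} (hK : n < K) (hn : s.reg .n = n)
    (hfact : ∀ i ≤ n, s.arr .fact i = i.factorial)
    (hf : Set.MapsTo f (Set.Iio n) (Set.Iio n)) (hinj : Set.InjOn f (Set.Iio n))
    (hleaf : s.reg .leaf = leafBelow f n 0) :
    wp K walkToLeaf (fun s' => ∀ i < n, s'.arr .q i = f i) s := by
  classical
  simp only [walkToLeaf, wp_block_cons, wp_assign]
  refine wp_forLoop n (fun d s' => ∀ l < d, s'.arr .used l = 0) hK rfl (by simp) ?_ ?_ ?_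
  · intro s' hF
    simp [hF.reg .n rfl, hn]
  · intro d s₁ hd hd₁ hI hF
    simp [hd₁, Function.update_apply]
    exact fun l hl h => hI l (by omega)
  rintro s₁ - hused₁ hF₁
  rw [wp_block_singleton]
  refine wp_forLoop n (fun d s' => s'.reg .rem = leafBelow f n d ∧ (∀ i < d, s'.arr .q i = f i) ∧
      ∀ l < n, s'.arr .used l = if ∃ i < d, f i = l then 1 else 0) hK rfl ?_ ?_ ?_ ?_
  · simp [hF₁.reg .rem rfl, hleaf]
    exact hused₁
  · intro s' hF
    simp [hF.reg .n rfl, hF₁.reg .n rfl, hn]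
  · rintro d s₂ hd hd₂ ⟨hrem, hq, hused⟩ hF₂
    have hn₂ : s₂.reg .n = n := by simp [hF₂.reg .n rfl, hF₁.reg .n rfl, hn]
    have hfact₂ : s₂.arr .fact (n - 1 - d) = (n - 1 - d).factorial := by
      rw [hF₂.arr .fact rfl, hF₁.arr .fact rfl]
      exact hfact _ (by omega)
    have hcard := card_unusedBelow_lt hd hf hinj
    have hfd : f d < n := hf (show d < n from hd)
    have hfactpos : 0 < (n - 1 - d).factorial := Nat.factorial_pos _
    have hlb := leafBelow_lt hf hinj (show d + 1 ≤ n from hd)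
    rw [show n - (d + 1) = n - 1 - d by omega] at hlb
    rw [wp_block_cons, wp_assign, wp_block_cons]
    refine wp_loop (fun s' => s'.reg .c ≤ (unusedBelow f d 0).card ∧ s'.reg .rem =
        ((unusedBelow f d 0).card - s'.reg .c) * (n - 1 - d).factorial + leafBelow f n (d + 1))
      (fun s' => (unusedBelow f d 0).card - s'.reg .c) ?_ ?_ ?_ ?_
    · simp [hrem, leafBelow_of_lt f hd]
    · simp
      omega
    · rintro s₃ ⟨h1, h2⟩ he hF
      have h3 : s₃.reg .n = n := by simp [hF.reg .n rfl, hn₂]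
      have h4 : s₃.reg .d = d := by simp [hF.reg .d rfl, hd₂]
      have h5 : s₃.arr .fact (n - 1 - d) = (n - 1 - d).factorial := by
        simp [hF.arr .fact rfl, hfact₂]
      simp [h3, h4, h5] at he ⊢
      have hlt : s₃.reg .c < (unusedBelow f d 0).card := by
        by_contra hge
        rw [show (unusedBelow f d 0).card - s₃.reg .c = 0 by omega] at h2
        omega
      refine ⟨⟨hlt, ?_⟩, by omega⟩
      obtain ⟨t, ht⟩ := Nat.exists_eq_add_one_of_ne_zero
        (show (unusedBelow f d 0).card - s₃.reg .c ≠ 0 by omega)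
      rw [h2, ht, show (unusedBelow f d 0).card - (s₃.reg .c + 1) = t by omega, add_mul]
      omega
    rintro s₃ ⟨h1, h2⟩ he hF₃
    have hc₃ : s₃.reg .c = (unusedBelow f d 0).card := by
      have h3 : s₃.reg .n = n := by simp [hF₃.reg .n rfl, hn₂]
      have h4 : s₃.reg .d = d := by simp [hF₃.reg .d rfl, hd₂]
      have h5 : s₃.arr .fact (n - 1 - d) = (n - 1 - d).factorial := by
        simp [hF₃.arr .fact rfl, hfact₂]
      simp [h3, h4, h5] at he
      by_contra hne
      obtain ⟨t, ht⟩ := Nat.exists_eq_add_one_of_ne_zero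
        (show (unusedBelow f d 0).card - s₃.reg .c ≠ 0 by omega)
      rw [ht, add_mul] at h2
      omega
    rw [hc₃, Nat.sub_self, Nat.zero_mul, Nat.zero_add] at h2
    rw [wp_block_cons, wp_assign, wp_block_cons]
    have hused₃ : s₃.arr .used = s₂.arr .used := by simp [hF₃.arr .used rfl]
    refine wp_loop (fun s' => s'.reg .label ≤ f d ∧
        s'.reg .c = (unusedBelow f d (s'.reg .label)).card)
      (fun s' => f d - s'.reg .label) ?_ ?_ ?_ ?_
    · simp [hc₃]
    · simp
      omega
    · rintro s₄ ⟨h3, h4⟩ he hF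
      have h5 : s₄.arr .used = s₂.arr .used := by simp [hF.arr .used rfl, hused₃]
      have hlt : s₄.reg .label < f d := by
        -- At the label `f d` both summands of the test vanish: there is nothing left to skip, and
        -- injectivity makes `f d` unused.
        refine lt_of_le_of_ne h3 fun heq => he ?_
        simp only [Expr.eval_add, Expr.eval_get, Expr.eval_reg, h4, h5, heq]
        rw [hused _ hfd, if_neg, unusedBelow, Finset.Ico_self]
        · simp
        · rintro ⟨i, hi, h⟩
          have := hinj (show i < n by omega) (show d < n by omega) h
          omega
      have h6 := hused _ (hlt.trans hfd)
      have h7 := unusedBelow_of_lt hlt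
      simp [h5]
      refine ⟨fun h => ?_, fun h => ?_⟩
      · refine ⟨⟨by omega, ?_⟩, by omega⟩
        rw [h] at h6
        rw [if_neg (fun h => by simp [h] at h6)] at h7
        rw [h4, h7, Finset.card_insert_of_notMem (by simp [unusedBelow])]
        rfl
      · refine ⟨⟨by omega, ?_⟩, by omega⟩
        rw [if_pos (by by_contra h'; simp [h'] at h6; exact h h6)] at h7
        rw [h4, h7]
    rintro s₄ ⟨h3, h4⟩ he hF₄
    have hused₄ : s₄.arr .used = s₂.arr .used := by simp [hF₄.arr .used rfl, hused₃]
    -- Before `f d` the loop cannot stop: the current label is used, or it is itself counted by `c`.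
    have hlabel : s₄.reg .label = f d := by
      by_contra hne
      have hlt : s₄.reg .label < f d := lt_of_le_of_ne h3 hne
      have h6 := hused _ (hlt.trans hfd)
      have h7 := unusedBelow_of_lt hlt
      simp [hused₄] at he
      rw [if_neg (fun h => by simp [h] at h6; omega)] at h7
      rw [h4, h7, Finset.card_insert_of_notMem (by simp [unusedBelow])] at he
      omega
    have hd₄ : s₄.reg .d = d := by simp [hF₄.reg .d rfl, hF₃.reg .d rfl, hd₂]
    have hq₄ : s₄.arr .q = s₂.arr .q := by simp [hF₄.arr .q rfl, hF₃.arr .q rfl]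
    have hrem₄ : s₄.reg .rem = s₃.reg .rem := by simp [hF₄.reg .rem rfl]
    simp [hlabel, hd₄, hq₄, hrem₄, hused₄, h2, Function.update_apply]
    refine ⟨fun i hi => ?_, fun l hl => ?_⟩
    · split_ifs with h
      · rw [h]
      · exact hq i (by omega)
    · have key : (∃ i ≤ d, f i = l) ↔ l = f d ∨ ∃ i < d, f i = l := by
        constructor
        · rintro ⟨i, hi, rfl⟩
          rcases Nat.lt_or_eq_of_le hi with h | rfl
          · exact Or.inr ⟨i, h, rfl⟩
          · exact Or.inl rfl
        · rintro (rfl | ⟨i, hi, rfl⟩)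
          · exact ⟨d, le_rfl, rfl⟩
          · exact ⟨i, hi.le, rfl⟩
      rw [hused l hl]
      simp only [key]
      by_cases h : l = f d <;> simp [h]
  · rintro s' - ⟨-, h, -⟩ -
    exact h

/-- A permutation of `Fin n` as a function on the natural numbers. -/
def natFun {n : ℕ} (q : Perm (Fin n)) (i : ℕ) : ℕ := if h : i < n then q ⟨i, h⟩ else i

theorem natFun_of_lt {n i : ℕ} (q : Perm (Fin n)) (h : i < n) : natFun q i = q ⟨i, h⟩ := by
  simp [natFun, h]

@[simp] theorem natFun_val {n : ℕ} (q : Perm (Fin n)) (i : Fin n) : natFun q i = q i := by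
  simp [natFun]

theorem mapsTo_natFun {n : ℕ} (q : Perm (Fin n)) :
    Set.MapsTo (natFun q) (Set.Iio n) (Set.Iio n) := by
  intro i hi
  rw [natFun_of_lt q hi]
  exact (q _).2

theorem injOn_natFun {n : ℕ} (q : Perm (Fin n)) : Set.InjOn (natFun q) (Set.Iio n) := by
  intro i hi j hj h
  rw [natFun_of_lt q hi, natFun_of_lt q hj] at h
  exact congrArg Fin.val (q.injective (Fin.ext h))

/-- The program serves as a decoder. If two permutations have the same leaf number, one and the same
run writes both of them into the array `q`, so they agree. -/
theorem leafBelow_natFun_injective (n : ℕ) :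
    Function.Injective fun q : Perm (Fin n) => leafBelow (natFun q) n 0 := by
  intro q q' h
  dsimp only at h
  -- Only `n`, `leaf` and the factorials matter; the walk initializes whatever else it reads, so
  -- other registers and arrays may hold anything.
  let s : State Reg Arr :=
    ⟨fun z => if z = .n then n else leafBelow (natFun q) n 0, fun _ i => i.factorial⟩
  obtain ⟨s', h1, h2⟩ := exists_of_wp (s := s) (c := walkToLeaf) (K := n + 2) (by omega)
    (wp_and
      (walkToLeaf_spec (n := n) (by omega) rfl (fun _ _ => rfl) (mapsTo_natFun q)
        (injOn_natFun q) rfl)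
      (walkToLeaf_spec (n := n) (by omega) rfl (fun _ _ => rfl) (mapsTo_natFun q') (injOn_natFun q') h))
  ext i
  have := (h1 i i.2).symm.trans (h2 i i.2)
  simpa using this

/-- Every leaf of the symmetric permutation tree belongs to a permutation. -/
theorem exists_leafBelow_eq {n l : ℕ} (hl : l < n.factorial) :
    ∃ q : Perm (Fin n), leafBelow (natFun q) n 0 = l := by
  let F : Perm (Fin n) → Fin n.factorial := fun q =>
    ⟨leafBelow (natFun q) n 0, leafBelow_lt (mapsTo_natFun q) (injOn_natFun q) (Nat.zero_le _)⟩
  have hF : Function.Bijective F := by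
    rw [Fintype.bijective_iff_injective_and_card]
    refine ⟨fun q q' h => leafBelow_natFun_injective n (by simpa [F] using h), ?_⟩
    simp [Fintype.card_perm]
  obtain ⟨q, hq⟩ := hF.2 ⟨l, hl⟩
  exact ⟨q, by simpa [F] using hq⟩

end BTU

/-! ### Cycle structure and the elements of `Z(m, 3)` -/

namespace BTU

open Equiv RAM RAM.Cmd Function

variable {K : ℕ} {s : State Reg Arr}

theorem cycleLength_spec {n : ℕ} (hK : n < K) (hn : 0 < n) (q : Perm (Fin n))
    (hq : ∀ i < n, s.arr .q i = natFun q i) :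
    wp K cycleLength (fun s' => s'.reg .len = minimalPeriod q ⟨0, hn⟩) s := by
  have hval : ∀ i : Fin n, s.arr .q i = q i := fun i => by rw [hq i i.2, natFun_val]
  have hL : minimalPeriod q (⟨0, hn⟩ : Fin n) ≤ n := by
    simpa using minimalPeriod_le_card (f := q) (x := (⟨0, hn⟩ : Fin n))
  have hpos : 0 < minimalPeriod q (⟨0, hn⟩ : Fin n) :=
    minimalPeriod_pos_of_mem_periodicPts (q.injective.mem_periodicPts _)
  simp only [cycleLength, wp_block_cons, wp_block_singleton, wp_assign]
  refine wp_loop (fun s' => 1 ≤ s'.reg .len ∧ s'.reg .len ≤ minimalPeriod q (⟨0, hn⟩ : Fin n) ∧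
      s'.reg .x = (q^[s'.reg .len] ⟨0, hn⟩ : Fin n))
    (fun s' => n - s'.reg .len) ?_ ?_ ?_ ?_
  · have := hval ⟨0, hn⟩
    simp only at this
    simp [this]
    omega
  · simp
    omega
  · rintro s₁ ⟨h1, h2, h3⟩ he hF
    have hlt : s₁.reg .len < minimalPeriod q (⟨0, hn⟩ : Fin n) := by
      refine lt_of_le_of_ne h2 fun heq => he ?_
      rw [Expr.eval_reg, h3, heq, iterate_minimalPeriod]
    have hq₁ : s₁.arr .q = s.arr .q := by simp [hF.arr .q rfl]
    simp [h3, hq₁, hval]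
    refine ⟨⟨hlt, ?_⟩, by omega⟩
    rw [← iterate_succ_apply, iterate_succ_apply']
  · rintro s₁ ⟨h1, h2, h3⟩ he hF
    refine le_antisymm h2 (IsPeriodicPt.minimalPeriod_le (by omega) (Fin.ext ?_))
    rw [← h3]
    exact he

theorem isPeriodicPt_perm {α : Type*} {σ : Perm α} {t : ℕ} {x : α} : IsPeriodicPt σ t x ↔ (σ ^ t) x = x := by
  rw [IsPeriodicPt, IsFixedPt, Perm.iterate_eq_pow]

section Partition

variable {α : Type*} [Fintype α] [DecidableEq α]

/-- The size of a cycle is its order, and a power of a cycle is trivial as soon as it fixes one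
point that the cycle moves. -/
theorem card_support_cycleOf {σ : Perm α} {x : α} (hx : σ x ≠ x) :
    (σ.cycleOf x).support.card = minimalPeriod σ x := by
  have hc := Perm.isCycle_cycleOf σ hx
  rw [← hc.orderOf]
  have key : ∀ t, orderOf (σ.cycleOf x) ∣ t ↔ minimalPeriod σ x ∣ t := by
    intro t
    rw [orderOf_dvd_iff_pow_eq_one, hc.pow_eq_one_iff' (x := x) (by rwa [Perm.cycleOf_apply_self]),
      Perm.cycleOf_pow_apply_self, ← isPeriodicPt_iff_minimalPeriod_dvd, isPeriodicPt_perm]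
  exact Nat.dvd_antisymm ((key _).2 dvd_rfl) ((key _).1 dvd_rfl)

/-- Parts of size at least `2` are the sizes of nontrivial cycles, that is, periods of points, while
fixed points give parts `1`, which `2 ≤ n` excludes. The number of parts then follows from their
sum. -/
theorem parts_partition_eq_replicate_iff {σ : Perm α} {k n : ℕ} (hn : 2 ≤ n)
    (hkn : k * n = Fintype.card α) :
    σ.partition.parts = Multiset.replicate k n ↔ ∀ x, minimalPeriod σ x = n := by
  constructor
  · intro h x
    have h1 : ∀ l ∈ σ.partition.parts, l = n := fun l hl => Multiset.eq_of_mem_replicate (h ▸ hl)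
    have hx : σ x ≠ x := by
      intro hx
      have hlt : σ.support.card < Fintype.card α :=
        Finset.card_lt_univ_of_notMem (x := x) (by simpa using hx)
      have := h1 1 (by
        rw [Perm.parts_partition, Multiset.mem_add, Multiset.mem_replicate]
        exact Or.inr ⟨by omega, rfl⟩)
      omega
    rw [← card_support_cycleOf hx]
    apply h1
    rw [Perm.parts_partition, Multiset.mem_add, Perm.cycleType_def]
    exact Or.inl (Multiset.mem_map.2 ⟨σ.cycleOf x,
      Perm.cycleOf_mem_cycleFactorsFinset_iff.2 (by simpa using hx), rfl⟩)
  · intro h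
    have hx : ∀ x, σ x ≠ x := by
      intro x hx
      have := minimalPeriod_eq_one_iff_isFixedPt.2 hx
      rw [h x] at this
      omega
    have hsupp : σ.support = Finset.univ := Finset.eq_univ_of_forall fun x => by simpa using hx x
    have h1 : ∀ l ∈ σ.partition.parts, l = n := by
      intro l hl
      rw [Perm.parts_partition, hsupp, Finset.card_univ, Nat.sub_self, Multiset.replicate_zero,
        add_zero, Perm.cycleType_def, Multiset.mem_map] at hl
      obtain ⟨c, hc, rfl⟩ := hl
      have hc' : c ∈ σ.cycleFactorsFinset := hc
      obtain ⟨y, hy⟩ := (Perm.mem_cycleFactorsFinset_iff.1 hc').1.nonempty_support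
      rw [Perm.cycle_is_cycleOf hy hc', comp_apply, card_support_cycleOf (hx y), h y]
    rw [Multiset.eq_replicate]
    refine ⟨?_, h1⟩
    have h2 := σ.partition.parts_sum
    rw [Multiset.eq_replicate_of_mem h1, Multiset.sum_replicate, smul_eq_mul] at h2
    exact Nat.eq_of_mul_eq_mul_right (by omega) (h2.trans hkn.symm)

end Partition

/-- One orbit already fills the whole set, and the period is constant on an orbit. This is why it is
enough to follow the cycle through `0`. -/
theorem minimalPeriod_eq_card_of_eq_card {α : Type*} [Fintype α] {σ : Perm α} {x : α}
    (h : minimalPeriod σ x = Fintype.card α) (y : α) : minimalPeriod σ y = Fintype.card α := by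
  have hinj : Injective fun i : Fin (Fintype.card α) => σ^[i] x := by
    intro i j hij
    exact Fin.ext (iterate_injOn_Iio_minimalPeriod (f := σ) (x := x)
      (i.2.trans_eq h.symm) (j.2.trans_eq h.symm) hij)
  have hbij := (Fintype.bijective_iff_injective_and_card _).2 ⟨hinj, by simp⟩
  obtain ⟨i, rfl⟩ := hbij.2 y
  rw [minimalPeriod_apply_iterate (σ.injective.mem_periodicPts _), h]

theorem scale_apply {m k n : ℕ} (h : k * n = m) (q : Perm (Fin n)) (c : Fin k) (a : Fin n) :
    scale h q (finCongr h (finProdFinEquiv (c, a))) = finCongr h (finProdFinEquiv (c, q a)) := by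
  simp [scale, Equiv.permCongr_apply]

theorem scale_exists {m k n : ℕ} (h : k * n = m) (x : Fin m) :
    ∃ (c : Fin k) (a : Fin n), x = finCongr h (finProdFinEquiv (c, a)) := by
  obtain ⟨⟨c, a⟩, rfl⟩ := (finProdFinEquiv.trans (finCongr h)).surjective x
  exact ⟨c, a, rfl⟩

/-- In the coordinates block and offset, `k * q` fixes the block and applies `q` to the offset. -/
theorem minimalPeriod_scale {m k n : ℕ} (h : k * n = m) (q : Perm (Fin n)) (c : Fin k)
    (a : Fin n) : minimalPeriod (scale h q) (finCongr h (finProdFinEquiv (c, a))) =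
      minimalPeriod q a := by
  have key : ∀ t, (scale h q)^[t] (finCongr h (finProdFinEquiv (c, a))) =
      finCongr h (finProdFinEquiv (c, q^[t] a)) := by
    intro t
    induction t with
    | zero => rfl
    | succ t ih => rw [iterate_succ_apply', ih, scale_apply, iterate_succ_apply']
  rw [minimalPeriod_eq_minimalPeriod_iff]
  intro t
  rw [IsPeriodicPt, IsFixedPt, key, IsPeriodicPt, IsFixedPt, (finCongr h).injective.eq_iff,
    finProdFinEquiv.injective.eq_iff, Prod.mk.injEq, and_iff_right rfl]

theorem partitionBetween_scale_one {m k n : ℕ} (h : k * n = m) (hk : 0 < k) (hn : 2 ≤ n)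
    (q : Perm (Fin n)) : partitionBetween (scale h q) 1 = Multiset.replicate k n ↔
      minimalPeriod q (⟨0, by omega⟩ : Fin n) = n := by
  rw [partitionBetween, inv_one, one_mul,
    parts_partition_eq_replicate_iff hn (by rw [h, Fintype.card_fin])]
  constructor
  · intro hq
    rw [← minimalPeriod_scale h q ⟨0, hk⟩]
    exact hq _
  · intro hq x
    obtain ⟨c, a, rfl⟩ := scale_exists h x
    rw [minimalPeriod_scale]
    simpa using minimalPeriod_eq_card_of_eq_card (σ := q) (by simpa using hq) a

theorem finRotate_pow_val {m : ℕ} (t : ℕ) (x : Fin m) :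
    ((finRotate m ^ t) x : ℕ) = (x + t) % m := by
  induction t with
  | zero => simp [Nat.mod_eq_of_lt x.2]
  | succ t ih =>
    rw [pow_succ', Perm.mul_apply]
    obtain ⟨m, rfl⟩ : ∃ l, m = l + 1 := ⟨m - 1, by have := x.2; omega⟩
    rw [finRotate_apply, Fin.val_add, ih, Fin.val_one', ← Nat.add_mod, add_assoc]

theorem minimalPeriod_finRotate {m : ℕ} (x : Fin m) : minimalPeriod (finRotate m) x = m := by
  have hm : 0 < m := x.pos
  have key : ∀ t, minimalPeriod (finRotate m) x ∣ t ↔ m ∣ t := by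
    intro t
    rw [← isPeriodicPt_iff_minimalPeriod_dvd, isPeriodicPt_perm, Fin.ext_iff, finRotate_pow_val,
      ← Nat.mod_eq_of_lt x.2]
    have : (x % m + t) % m = x % m ↔ (x : ℕ) + t ≡ x + 0 [MOD m] := by
      rw [Nat.mod_add_mod]
      rfl
    rw [this, Nat.ModEq.add_iff_left rfl, Nat.modEq_zero_iff_dvd]
  exact Nat.dvd_antisymm ((key _).2 dvd_rfl) ((key _).1 dvd_rfl)

/-- The permutation in question is the `j`-th power of the rotation, all of whose points have period
`m / gcd(m, j) = m`. -/
theorem partitionBetween_one_circ {m j : ℕ} (hm : 2 ≤ m) (hj : 0 < j) (h : Nat.Coprime j m) :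
    partitionBetween 1 (circ m j) = {m} := by
  rw [partitionBetween, circ, inv_inv, mul_one, ← Multiset.replicate_one,
    parts_partition_eq_replicate_iff hm (by simp)]
  intro x
  rw [← Perm.iterate_eq_pow, minimalPeriod_iterate_eq_div_gcd hj.ne', minimalPeriod_finRotate,
    h.symm.gcd_eq_one, Nat.div_one]

theorem circ_apply_val {m j : ℕ} (hj : j < m) (x : Fin m) :
    (circ m j x : ℕ) = if (x : ℕ) < j then x + m - j else x - j := by
  have hx := x.2
  have key : ∀ y : Fin m, (y + j) % m = x → circ m j x = y := by
    intro y hy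
    rw [circ, Perm.inv_eq_iff_eq, Fin.ext_iff, finRotate_pow_val, hy]
  split_ifs with h
  · rw [key ⟨x + m - j, by omega⟩]
    simp only
    rw [show x + m - j + j = x + m by omega, Nat.add_mod_right, Nat.mod_eq_of_lt hx]
  · rw [key ⟨x - j, by omega⟩]
    simp only
    rw [show x - j + j = (x : ℕ) by omega, Nat.mod_eq_of_lt hx]

theorem scale_apply_val {m k n : ℕ} (h : k * n = m) (q : Perm (Fin n)) {c a : ℕ} (hc : c < k)
    (ha : a < n) (x : Fin m) (hx : (x : ℕ) = c * n + a) :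
    (scale h q x : ℕ) = c * n + natFun q a := by
  have : x = finCongr h (finProdFinEquiv (⟨c, hc⟩, ⟨a, ha⟩)) := by
    ext
    simp [hx]
    ring
  rw [this, scale_apply, natFun_of_lt q ha]
  simp
  ring

/-- The family `k * q`, `I`, `C_j`. -/
def family {m k n : ℕ} (h : k * n = m) (j : ℕ) (q : Perm (Fin n)) : Fin 3 → Perm (Fin m) :=
  ![scale h q, 1, circ m j]

theorem IsParam.unique {m b k b' k' : ℕ} (h : IsParam m b k) (h' : IsParam m b' k') :
    b = b' ∧ k = k' := by
  have hb : b = b' := le_antisymm (h.2.2 _ _ h'.1 h'.2.1) (h'.2.2 _ _ h.1 h.2.1)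
  subst hb
  refine ⟨rfl, ?_⟩
  have := h.2.1.symm.trans h'.2.1
  exact Nat.pow_left_injective two_ne_zero (Nat.eq_of_mul_eq_mul_left h.1 this)

/-- For `k ≤ 1` one would have `m ≤ b * k`, which leaves no room for an admissible shift. So blocks
have length at least `2`, as the criterion for partitions requires. -/
theorem Admissible.bounds {m b k j : ℕ} (hp : IsParam m b k) (hj : Admissible m b k j) :
    k * (b * k) = m ∧ 2 ≤ k ∧ 2 ≤ b * k ∧ b * k < j ∧ b * k + j < m := by
  have h1 : k * (b * k) = m := by rw [hp.2.1]; ring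
  have h2 := hj.1
  rw [lt_min_iff] at h2
  have hb := hp.1
  have hk : 2 ≤ k := by
    by_contra hk
    have : k * (b * k) ≤ 1 * (b * k) := Nat.mul_le_mul_right _ (by omega)
    omega
  refine ⟨h1, hk, ?_, h2.2, by omega⟩
  nlinarith

theorem compatible_family {m b k j : ℕ} (hp : IsParam m b k) (hj : Admissible m b k j)
    (h : k * (b * k) = m) (q : Perm (Fin (b * k)))
    (hq : minimalPeriod q (⟨0, by have := hj.bounds hp; omega⟩ : Fin (b * k)) = b * k) :
    Pairwise fun i i' => Compatible (family h j q i) (family h j q i') := by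
  obtain ⟨-, hk, hn, hnj, hjm⟩ := hj.bounds hp
  have h01 : Compatible (scale h q) 1 := by
    intro x hx
    have h1 := (partitionBetween_scale_one h (by omega) hn q).2 hq
    rw [partitionBetween, inv_one, one_mul,
      parts_partition_eq_replicate_iff hn (by rw [h, Fintype.card_fin])] at h1
    have h2 := minimalPeriod_eq_one_iff_isFixedPt.2 hx
    rw [h1 x] at h2
    omega
  have h12 : Compatible 1 (circ m j) := by
    intro x hx
    have h1 := congrArg Fin.val hx
    rw [circ_apply_val (by omega), Perm.one_apply] at h1
    split_ifs at h1 <;> omega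
  -- Here the inequality for admissible shifts enters: `k * q` moves a row by less than `n`, whereas
  -- `C_j` moves it by `j` or `m - j`, both larger than `n`.
  have h02 : Compatible (scale h q) (circ m j) := by
    intro x hx
    have h1 := congrArg Fin.val hx
    obtain ⟨c, a, rfl⟩ := scale_exists h x
    rw [circ_apply_val (by omega), scale_apply] at h1
    have ha := a.2
    have ha' := (q a).2
    simp at h1
    split_ifs at h1 <;> omega
  have hsymm : ∀ {p p' : Perm (Fin m)}, Compatible p p' → Compatible p' p :=
    fun h x hx => h x hx.symm
  intro i i' hii'
  fin_cases i <;> fin_cases i' <;> first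
    | exact absurd rfl hii'
    | exact h01
    | exact h02
    | exact h12
    | exact hsymm h01
    | exact hsymm h02
    | exact hsymm h12

theorem family_mem_Z {m b k j : ℕ} (hp : IsParam m b k) (hj : Admissible m b k j)
    (h : k * (b * k) = m) (q : Perm (Fin (b * k)))
    (hq : minimalPeriod q (⟨0, by have := hj.bounds hp; omega⟩ : Fin (b * k)) = b * k) :
    family h j q ∈ Z m := by
  obtain ⟨-, hk, hn, hnj, hjm⟩ := hj.bounds hp
  exact ⟨compatible_family hp hj h q hq, b, k, hp,
    (partitionBetween_scale_one h (by omega) hn q).2 hq,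
    partitionBetween_one_circ (by omega) (by omega) hj.2, rfl, h, q, rfl⟩

/-- Together with `family_mem_Z` this turns maximization over `Z(m, 3)` into maximization over pairs
of an admissible shift and a full cycle. Uniqueness of `b` and `k` identifies the block length
chosen inside `Z`. -/
theorem eq_family_of_mem_Z {m b k j : ℕ} (hp : IsParam m b k) (hj : Admissible m b k j)
    (h : k * (b * k) = m) {p : Fin 3 → Perm (Fin m)} (hpZ : p ∈ Z m) (hpj : p 2 = circ m j) :
    ∃ q : Perm (Fin (b * k)),
      minimalPeriod q (⟨0, by have := hj.bounds hp; omega⟩ : Fin (b * k)) = b * k ∧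
      p = family h j q := by
  obtain ⟨-, hk, hn, -⟩ := hj.bounds hp
  obtain ⟨-, b', k', hp', hpart, -, h1, h', q, h0⟩ := hpZ
  obtain ⟨rfl, rfl⟩ := hp.unique hp'
  rw [h0, h1, partitionBetween_scale_one h (by omega) hn] at hpart
  refine ⟨q, hpart, ?_⟩
  ext i : 1
  fin_cases i
  · exact h0
  · exact h1
  · exact hpj

theorem buildBTU_spec {m k n j : ℕ} (hK : m < K) (hkK : k < K) (hnK : n < K) (h : k * n = m)
    (hj : j < m) (q : Perm (Fin n)) (hm : s.reg .m = m) (hk : s.reg .k = k) (hn : s.reg .n = n)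
    (hjs : s.reg .j = j) (hq : ∀ i < n, s.arr .q i = natFun q i) :
    wp K buildBTU (fun s' => ∀ (i : Fin 3) (x : Fin m),
      s'.arr .P (i * m + x) = family h j q i x) s := by
  -- This is `k * q` on natural numbers: split into block and offset by division and apply `q` to
  -- the offset.
  set g : ℕ → ℕ := fun y => y / n * n + natFun q (y % n) with hg
  have hg' : ∀ c, ∀ a < n, g (c * n + a) = c * n + natFun q a := by
    intro c a ha
    simp only [hg]
    rw [mul_comm c n, Nat.mul_add_mod, Nat.mod_eq_of_lt ha, Nat.mul_add_div (by omega),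
      Nat.div_eq_of_lt ha, add_zero, mul_comm]
  simp only [buildBTU, wp_block_cons, wp_assign]
  refine wp_forLoop k (fun c s' => s'.reg .base = c * n ∧ ∀ y < c * n, s'.arr .P y = g y) hkK rfl
    ?_ ?_ ?_ ?_
  · simp
  · intro s' hF
    simp [hF.reg .k rfl, hk]
  · rintro c s₁ - hc₁ ⟨hbase, hP⟩ hF₁
    rw [wp_block_cons]
    refine wp_forLoop n (fun a s' => ∀ y < c * n + a, s'.arr .P y = g y) hnK rfl ?_ ?_ ?_ ?_
    · simpa using hP
    · intro s' hF
      simp [hF.reg .n rfl, hF₁.reg .n rfl, hn]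
    · intro a s₂ ha ha₂ hI hF₂
      have hb₂ : s₂.reg .base = c * n := by simp [hF₂.reg .base rfl, hbase]
      have hq₂ : s₂.arr .q = s.arr .q := by simp [hF₂.arr .q rfl, hF₁.arr .q rfl]
      simp only [wp_store, Expr.eval_add, Expr.eval_reg, Expr.eval_get, hb₂, hq₂, ha₂, hq a ha,
        State.arr_setReg, State.arr_setArr, if_true, Function.update_apply]
      intro y hy
      split_ifs with hya
      · rw [hya, hg' c a ha]
      · exact hI y (by omega)
    · rintro s₂ - hI hF₂
      have hb₂ : s₂.reg .base = c * n := by simp [hF₂.reg .base rfl, hbase]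
      have hn₂ : s₂.reg .n = n := by simp [hF₂.reg .n rfl, hF₁.reg .n rfl, hn]
      simp [hb₂, hn₂, add_mul]
      exact hI
  rintro s₁ - ⟨-, hP⟩ hF₁
  rw [wp_block_singleton]
  rw [h] at hP
  have hm₁ : s₁.reg .m = m := by simp [hF₁.reg .m rfl, hm]
  refine wp_forLoop m (fun x s' => (∀ y < m, s'.arr .P y = g y) ∧
    (∀ y < x, s'.arr .P (m + y) = y) ∧
    ∀ y < x, s'.arr .P (m + m + y) = if y < j then y + m - j else y - j) hK rfl ?_ ?_ ?_ ?_
  · simpa using hP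
  · intro s' hF
    simp [hF.reg .m rfl, hm₁]
  · rintro x s₂ hx hx₂ ⟨h1, h2, h3⟩ hF₂
    have hm₂ : s₂.reg .m = m := by simp [hF₂.reg .m rfl, hm₁]
    have hj₂ : s₂.reg .j = j := by simp [hF₂.reg .j rfl, hF₁.reg .j rfl, hjs]
    simp only [wp_block_cons, wp_block_singleton, wp_store, wp_ite, Expr.eval_add, Expr.eval_sub,
      Expr.eval_lt, Expr.eval_reg, hm₂, hj₂, hx₂, State.reg_setArr, State.arr_setReg,
      State.arr_setArr, if_true, Function.update_apply, not_not]
    refine ⟨fun hlt => ⟨fun y hy => ?_, fun y hy => ?_, fun y hy => ?_⟩,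
      fun hlt => ⟨fun y hy => ?_, fun y hy => ?_, fun y hy => ?_⟩⟩
    · rw [if_neg (by omega), if_neg (by omega)]
      exact h1 y hy
    · rw [if_neg (by omega)]
      split_ifs with hyx
      · omega
      · exact h2 y (by omega)
    · by_cases hyx : y = x
      · rw [hyx, if_pos rfl, if_pos hlt]
      · rw [if_neg (by omega), if_neg (by omega)]
        exact h3 y (by omega)
    · rw [if_neg (by omega), if_neg (by omega)]
      exact h1 y hy
    · rw [if_neg (by omega)]
      split_ifs with hyx
      · omega
      · exact h2 y (by omega)
    · by_cases hyx : y = x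
      · rw [hyx, if_pos rfl, if_neg hlt]
      · rw [if_neg (by omega), if_neg (by omega)]
        exact h3 y (by omega)
  · rintro s' - ⟨h1, h2, h3⟩ - i x
    fin_cases i
    · obtain ⟨c, a, rfl⟩ := scale_exists h x
      have hx : (finCongr h (finProdFinEquiv (c, a)) : ℕ) = c * n + a := by
        simp
        ring
      have := h1 _ (finCongr h (finProdFinEquiv (c, a))).2
      rw [hx, hg' c a a.2] at this
      change s'.arr .P (0 * m + (finCongr h (finProdFinEquiv (c, a)) : ℕ)) =
        (scale h q (finCongr h (finProdFinEquiv (c, a))) : ℕ)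
      rw [scale_apply_val h q c.2 a.2 _ hx, zero_mul, zero_add, hx]
      exact this
    · simpa [family] using h2 x x.2
    · have := h3 x x.2
      rw [← circ_apply_val hj] at this
      simpa [family, two_mul] using this

/-! ### Breadth first search -/

/-- What breadth first search from row `a` has to compute: every row and column is marked with its
distance from row `a`, plus one, or with `0` if there is no path to it.  The distances refer to the
graph of the edges `(x, y)` with `E x y`. -/
structure IsMarking (m a : ℕ) (E : ℕ → ℕ → Prop) (L R : ℕ → ℕ) : Prop where
  start : ∀ x < m, L x = 1 ↔ x = a
  ne_one : ∀ y < m, R y ≠ 1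
  le : ∀ y < m, R y ≤ m + m + 1
  next : ∀ x < m, ∀ y < m, E x y → ∀ t, L x = t + 1 → 0 < R y ∧ R y ≤ t + 2
  next' : ∀ x < m, ∀ y < m, E x y → ∀ t, R y = t + 1 → 0 < L x ∧ L x ≤ t + 2
  prev : ∀ y < m, ∀ t, R y = t + 2 → ∃ x < m, E x y ∧ L x = t + 1
  prev' : ∀ x < m, ∀ t, L x = t + 2 → ∃ y < m, E x y ∧ R y = t + 1

/-- The marks `d` agree with the marks `D` up to the mark `t + 1`; some of the marks `t + 2` are
there, too. -/
structure IsPartialMarking (m t : ℕ) (D d : ℕ → ℕ) : Prop where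
  eq : ∀ x < m, D x ≤ t + 1 → d x = D x
  zero_or : ∀ x < m, t + 1 < D x → d x = 0 ∨ d x = D x ∧ D x = t + 2

/-- An empty cell with a positive target has a target above `t + 1`, since lower marks are already
in place. So the new mark `t + 2` is the exact one. -/
theorem IsPartialMarking.update {m t : ℕ} {D d : ℕ → ℕ} (h : IsPartialMarking m t D d) {y : ℕ}
    (hy : y < m) (h0 : 0 < D y) (hle : D y ≤ t + 2) (hd : d y = 0) :
    IsPartialMarking m t D (update d y (t + 2)) := by
  have hDy : D y = t + 2 := by
    by_contra hne
    have := h.eq y hy (by omega)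
    omega
  constructor
  · intro x hx hD
    have hxy : x ≠ y := by
      rintro rfl
      omega
    rw [update_of_ne hxy]
    exact h.eq x hx hD
  · intro x hx hD
    rcases eq_or_ne x y with rfl | hxy
    · rw [update_self]
      exact Or.inr ⟨hDy.symm, hDy⟩
    · rw [update_of_ne hxy]
      exact h.zero_or x hx hD

/-- Marks written during the current phase are `t + 2`, so they never disturb the test for `t + 1`.
That is why one pass can update rows and columns in place. -/
theorem IsPartialMarking.eq_iff {m t : ℕ} {D d : ℕ → ℕ} (h : IsPartialMarking m t D d) {x : ℕ}
    (hx : x < m) : d x = t + 1 ↔ D x = t + 1 := by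
  rcases le_or_gt (D x) (t + 1) with hD | hD
  · rw [h.eq x hx hD]
  · have := h.zero_or x hx hD
    omega

/-- The marks during phase `t` of breadth first search; `done i x` tells whether the edge number `i`
of row `x`, which ends in column `col i x`, has been processed. -/
structure SearchInv (m t : ℕ) (L R dL dR : ℕ → ℕ) (col : ℕ → ℕ → ℕ) (done : ℕ → ℕ → Prop) :
    Prop where
  left : IsPartialMarking m t L dL
  right : IsPartialMarking m t R dR
  done_left : ∀ i x, done i x → L x = t + 1 → dR (col i x) ≠ 0
  done_right : ∀ i x, done i x → R (col i x) = t + 1 → dL x ≠ 0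

section

variable {m t a : ℕ} {L R dL dR : ℕ → ℕ} {col : ℕ → ℕ → ℕ} {done done' ok : ℕ → ℕ → Prop}

theorem SearchInv.mono (h : SearchInv m t L R dL dR col done)
    (hd : ∀ i x, done' i x → done i x) : SearchInv m t L R dL dR col done' :=
  ⟨h.left, h.right, fun i x hx => h.done_left i x (hd i x hx),
    fun i x hx => h.done_right i x (hd i x hx)⟩

/-- The array after the conditional store is described by two implications, one for each branch, so
that the same lemma serves both. -/
theorem SearchInv.left_step (h : SearchInv m t L R dL dR col done) {i x : ℕ} (hx : x < m)
    (hy : col i x < m) (hnext : ∀ t, L x = t + 1 → 0 < R (col i x) ∧ R (col i x) ≤ t + 2) :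
    ∀ dR', (dL x = t + 1 ∧ dR (col i x) = 0 → dR' = update dR (col i x) (t + 2)) →
      (¬ (dL x = t + 1 ∧ dR (col i x) = 0) → dR' = dR) →
      SearchInv m t L R dL dR' col done ∧ (L x = t + 1 → dR' (col i x) ≠ 0) := by
  intro dR' h1 h2
  by_cases hc : dL x = t + 1 ∧ dR (col i x) = 0
  · rw [h1 hc]
    have hLx := (h.left.eq_iff hx).1 hc.1
    refine ⟨⟨h.left, h.right.update hy (hnext t hLx).1 (hnext t hLx).2 hc.2, fun i' x' hd hL => ?_,
      h.done_right⟩, fun _ => by simp⟩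
    rw [update_apply]
    split_ifs
    · omega
    · exact h.done_left i' x' hd hL
  · rw [h2 hc]
    refine ⟨h, fun hLx h0 => hc ⟨(h.left.eq_iff hx).2 hLx, h0⟩⟩

theorem SearchInv.right_step (h : SearchInv m t L R dL dR col done) {i x : ℕ} (hx : x < m)
    (hy : col i x < m) (hnext : ∀ t, R (col i x) = t + 1 → 0 < L x ∧ L x ≤ t + 2)
    (hl : L x = t + 1 → dR (col i x) ≠ 0) :
    ∀ dL', (dR (col i x) = t + 1 ∧ dL x = 0 → dL' = update dL x (t + 2)) →
      (¬ (dR (col i x) = t + 1 ∧ dL x = 0) → dL' = dL) →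
      SearchInv m t L R dL' dR col (fun i' x' => done i' x' ∨ i' = i ∧ x' = x) := by
  intro dL' h1 h2
  by_cases hc : dR (col i x) = t + 1 ∧ dL x = 0
  · rw [h1 hc]
    have hR := (h.right.eq_iff hy).1 hc.1
    refine ⟨h.left.update hx (hnext t hR).1 (hnext t hR).2 hc.2, h.right, ?_, ?_⟩
    · rintro i' x' (hd | ⟨rfl, rfl⟩) hL
      · exact h.done_left i' x' hd hL
      · exact hl hL
    · rintro i' x' (hd | ⟨rfl, rfl⟩) hR
      · rw [update_apply]
        split_ifs
        · omega
        · exact h.done_right i' x' hd hR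
      · simp
  · rw [h2 hc]
    refine ⟨h.left, h.right, ?_, ?_⟩
    · rintro i' x' (hd | ⟨rfl, rfl⟩) hL
      · exact h.done_left i' x' hd hL
      · exact hl hL
    · rintro i' x' (hd | ⟨rfl, rfl⟩) hR
      · exact h.done_right i' x' hd hR
      · exact fun h0 => hc ⟨(h.right.eq_iff hy).2 hR, h0⟩

theorem SearchInv.start (hM : IsMarking m a (fun x y => ∃ i < 3, ok i x ∧ col i x = y) L R)
    (hdL : ∀ x < m, dL x = if x = a then 1 else 0) (hdR : ∀ y < m, dR y = 0) :
    SearchInv m 0 L R dL dR col (fun _ _ => False) := by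
  refine ⟨⟨fun x hx h => ?_, fun x hx h => ?_⟩, ⟨fun y hy h => ?_, fun y hy h => ?_⟩,
    fun _ _ h => h.elim, fun _ _ h => h.elim⟩
  · rw [hdL x hx]
    have := hM.start x hx
    split_ifs with hxa
    · exact (this.2 hxa).symm
    · have := mt this.1 hxa
      omega
  · have := hM.start x hx
    rw [hdL x hx, if_neg (fun hxa => by have := this.2 hxa; omega)]
    exact Or.inl rfl
  · have := hM.ne_one y hy
    rw [hdR y hy]
    omega
  · exact Or.inl (hdR y hy)

/-- A vertex with mark `t + 2` has a neighbour with mark `t + 1`. The edge between them has been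
processed, so the vertex is no longer unmarked, and the only mark it can carry is the correct one.
-/
theorem SearchInv.next_phase (hM : IsMarking m a (fun x y => ∃ i < 3, ok i x ∧ col i x = y) L R)
    (h : SearchInv m t L R dL dR col (fun i x => i < 3 ∧ x < m ∧ ok i x)) :
    SearchInv m (t + 1) L R dL dR col (fun _ _ => False) := by
  refine ⟨⟨fun x hx hle => ?_, fun x hx h' => ?_⟩, ⟨fun y hy hle => ?_, fun y hy h' => ?_⟩,
    fun _ _ h => h.elim, fun _ _ h => h.elim⟩
  · rcases Nat.lt_or_ge (t + 1) (L x) with hlt | hge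
    · obtain ⟨y, hy, ⟨i, hi, hok, rfl⟩, hR⟩ := hM.prev' x hx t (by omega)
      have := h.left.zero_or x hx hlt
      have := h.done_right i x ⟨hi, hx, hok⟩ hR
      omega
    · exact h.left.eq x hx hge
  · have := h.left.zero_or x hx (by omega)
    omega
  · rcases Nat.lt_or_ge (t + 1) (R y) with hlt | hge
    · obtain ⟨x, hx, ⟨i, hi, hok, rfl⟩, hL⟩ := hM.prev y hy t (by omega)
      have := h.right.zero_or _ hy hlt
      have := h.done_left i x ⟨hi, hx, hok⟩ hL
      omega
    · exact h.right.eq y hy hge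
  · have := h.right.zero_or y hy (by omega)
    omega

end

theorem search_spec {m a e : ℕ} {L R : ℕ → ℕ} {col : ℕ → ℕ → ℕ} (hK : m + m < K) (h3K : 3 < K)
    (hm : s.reg .m = m) (has : s.reg .a = a) (hes : s.reg .e = e)
    (hP : ∀ i < 3, ∀ x < m, s.arr .P (i * m + x) = col i x)
    (hcol : ∀ i < 3, ∀ x < m, col i x < m)
    (hM : IsMarking m a (fun x y => ∃ i < 3, ¬ (x = a ∧ i = e) ∧ col i x = y) L R) :
    wp K search (fun s' => ∀ y < m, s'.arr .dR y = R y) s := by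
  simp only [search, wp_block_cons]
  refine wp_forLoop m (fun x s' => ∀ y < x, s'.arr .dL y = 0 ∧ s'.arr .dR y = 0) (by omega) rfl
    (by simp) ?_ ?_ ?_
  · intro s' hF
    simp [hF.reg .m rfl, hm]
  · intro x s₁ hx hx₁ hI hF
    simp [hx₁, update_apply]
    exact fun y hy => ⟨fun h => (hI y (by omega)).1, fun h => (hI y (by omega)).2⟩
  rintro s₁ - hzero hF₁
  rw [wp_block_cons, wp_store, wp_block_singleton]
  have hm₁ : s₁.reg .m = m := by simp [hF₁.reg .m rfl, hm]
  have ha₁ : s₁.reg .a = a := by simp [hF₁.reg .a rfl, has]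
  have he₁ : s₁.reg .e = e := by simp [hF₁.reg .e rfl, hes]
  have hP₁ : s₁.arr .P = s.arr .P := by simp [hF₁.arr .P rfl]
  -- After `2 * m` phases all marks up to `2 * m + 1` are final, which covers every mark in use.
  refine wp_forLoop (m + m) (fun t s' => SearchInv m t L R (s'.arr .dL) (s'.arr .dR) col
    (fun _ _ => False)) hK rfl ?_ ?_ ?_ ?_
  · refine SearchInv.start hM (fun x hx => ?_) fun y hy => ?_
    · simp [ha₁, update_apply, (hzero x hx).1]
    · simp [(hzero y hy).2]
  · intro s' hF
    simp [hF.reg .m rfl, hm₁]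
  · intro t s₂ ht ht₂ hI₂ hF₂
    have hm₂ : s₂.reg .m = m := by simp [hF₂.reg .m rfl, hm₁]
    have ha₂ : s₂.reg .a = a := by simp [hF₂.reg .a rfl, ha₁]
    have he₂ : s₂.reg .e = e := by simp [hF₂.reg .e rfl, he₁]
    have hP₂ : s₂.arr .P = s.arr .P := by simp [hF₂.arr .P rfl, hP₁]
    refine wp_forLoop m (fun x s' => SearchInv m t L R (s'.arr .dL) (s'.arr .dR) col
      (fun i x' => i < 3 ∧ x' < x ∧ ¬ (x' = a ∧ i = e))) (by omega) rfl ?_ ?_ ?_ ?_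
    · exact SearchInv.mono hI₂ (by simp)
    · intro s' hF
      simp [hF.reg .m rfl, hm₂]
    · intro x s₃ hx hx₃ hI₃ hF₃
      have hm₃ : s₃.reg .m = m := by simp [hF₃.reg .m rfl, hm₂]
      have ha₃ : s₃.reg .a = a := by simp [hF₃.reg .a rfl, ha₂]
      have he₃ : s₃.reg .e = e := by simp [hF₃.reg .e rfl, he₂]
      have ht₃ : s₃.reg .s = t := by simp [hF₃.reg .s rfl, ht₂]
      have hP₃ : s₃.arr .P = s.arr .P := by simp [hF₃.arr .P rfl, hP₂]
      rw [wp_block_cons, wp_assign, wp_block_singleton]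
      refine wp_forLoop 3 (fun i s' => s'.reg .off' = i * m ∧
        SearchInv m t L R (s'.arr .dL) (s'.arr .dR) col
        (fun i' x' => i' < 3 ∧ (x' < x ∨ x' = x ∧ i' < i) ∧ ¬ (x' = a ∧ i' = e))) h3K rfl ?_ ?_ ?_ ?_
      · exact ⟨by simp, SearchInv.mono hI₃ (by simp)⟩
      · intro s' hF
        rfl
      · rintro i s₄ hi hi₄ ⟨hoff, hI₄⟩ hF₄
        have hm₄ : s₄.reg .m = m := by simp [hF₄.reg .m rfl, hm₃]
        have ha₄ : s₄.reg .a = a := by simp [hF₄.reg .a rfl, ha₃]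
        have he₄ : s₄.reg .e = e := by simp [hF₄.reg .e rfl, he₃]
        have ht₄ : s₄.reg .s = t := by simp [hF₄.reg .s rfl, ht₃]
        have hx₄ : s₄.reg .x = x := by simp [hF₄.reg .x rfl, hx₃]
        have hP₄ : s₄.arr .P (i * m + x) = col i x := by
          rw [← hP i hi x hx, hF₄.arr .P rfl, State.arr_setReg, hP₃]
        have hmul : (i + 1) * m = i * m + m := by ring
        simp only [wp_block_cons, wp_block_singleton, wp_when, wp_assign, wp_store, Expr.eval_not,
          Expr.eval_and, Expr.eval_eq, Expr.eval_reg, Expr.eval_add, Expr.eval_lit, Expr.eval_get,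
          State.reg_setReg, State.reg_setArr, State.arr_setReg, State.arr_setArr, reduceCtorEq,
          if_false, if_true, not_not, hm₄, ha₄, he₄, ht₄, hx₄, hi₄, hoff, hP₄, hmul, true_and]
        have hnext := hM.next x hx (col i x) (hcol i hi x hx)
        have hnext' := hM.next' x hx (col i x) (hcol i hi x hx)
        refine ⟨fun hok => ?_, fun hok => hI₄.mono ?_⟩
        · have hstep := hI₄.left_step hx (hcol i hi x hx) (hnext ⟨i, hi, hok, rfl⟩)
          have hdone : ∀ i' x', i' < 3 ∧ (x' < x ∨ x' = x ∧ i' < i + 1) ∧ ¬(x' = a ∧ i' = e) →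
              (i' < 3 ∧ (x' < x ∨ x' = x ∧ i' < i) ∧ ¬(x' = a ∧ i' = e)) ∨ i' = i ∧ x' = x := by
            rintro i' x' ⟨h1, h2, h3⟩
            by_cases h : i' = i ∧ x' = x
            · exact Or.inr h
            · exact Or.inl ⟨h1, by omega, h3⟩
          refine ⟨fun hc => ?_, fun hc => ?_⟩
          · obtain ⟨h1, h2⟩ := hstep _ (fun _ => rfl) (fun h => absurd hc h)
            have h3 := h1.right_step hx (hcol i hi x hx) (hnext' ⟨i, hi, hok, rfl⟩) h2
            refine ⟨fun hc' => (h3 _ (fun _ => rfl) (fun h => absurd hc' h)).mono hdone,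
              fun hc' => (h3 _ (fun h => absurd h hc') (fun _ => rfl)).mono hdone⟩
          · obtain ⟨h1, h2⟩ := hstep _ (fun h => absurd h hc) (fun _ => rfl)
            have h3 := h1.right_step hx (hcol i hi x hx) (hnext' ⟨i, hi, hok, rfl⟩) h2
            refine ⟨fun hc' => (h3 _ (fun _ => rfl) (fun h => absurd hc' h)).mono hdone,
              fun hc' => (h3 _ (fun h => absurd h hc') (fun _ => rfl)).mono hdone⟩
        -- The deleted edge is never counted as processed, so skipping it enlarges nothing.
        · rintro i' x' ⟨h1, h2, h3⟩
          refine ⟨h1, ?_, h3⟩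
          by_contra h
          have h4 : x' = x ∧ i' = i := by omega
          exact h3 (by rwa [h4.1, h4.2])
      · rintro s₄ - ⟨-, hI₄⟩ -
        exact SearchInv.mono hI₄ fun i x' h => ⟨h.1, by omega, h.2.2⟩
    · rintro s₃ - hI₃ -
      exact hI₃.next_phase hM
  · rintro s₂ - hI₂ - y hy
    exact hI₂.right.eq y hy (hM.le y hy)

end BTU

/-! ### Distances and cycles through an edge -/

namespace SimpleGraph

variable {V : Type*} {G : SimpleGraph V} {u v w : V}

open Classical in
/-- The distance from `u` plus one, or `0` for the vertices that cannot be reached. -/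
noncomputable def mark (G : SimpleGraph V) (u v : V) : ℕ :=
  if G.Reachable u v then G.dist u v + 1 else 0

theorem mark_eq_succ_iff {t : ℕ} : G.mark u v = t + 1 ↔ G.Reachable u v ∧ G.dist u v = t := by
  unfold mark
  split_ifs with h <;> simp [h]

theorem mark_pos_iff : 0 < G.mark u v ↔ G.Reachable u v := by
  unfold mark
  split_ifs with h <;> simp [h]

theorem mark_eq_one_iff : G.mark u v = 1 ↔ v = u := by
  rw [show (1 : ℕ) = 0 + 1 from rfl, mark_eq_succ_iff]
  constructor
  · rintro ⟨h, h'⟩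
    exact (h.dist_eq_zero_iff.1 h').symm
  · rintro rfl
    simp

theorem mark_of_adj (h : G.Adj v w) {t : ℕ} (hv : G.mark u v = t + 1) :
    0 < G.mark u w ∧ G.mark u w ≤ t + 2 := by
  obtain ⟨hr, hd⟩ := mark_eq_succ_iff.1 hv
  have hw : G.Reachable u w := hr.trans h.reachable
  refine ⟨mark_pos_iff.2 hw, ?_⟩
  have h1 : G.mark u w = G.dist u w + 1 := mark_eq_succ_iff.2 ⟨hw, rfl⟩
  obtain ⟨p, hp⟩ := hr.exists_walk_length_eq_dist
  have := dist_le (p.concat h)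
  rw [Walk.length_concat] at this
  omega

/-- The vertex sought is the last but one on a shortest path. -/
theorem exists_adj_of_mark {t : ℕ} (hw : G.mark u w = t + 2) :
    ∃ v, G.Adj v w ∧ G.mark u v = t + 1 := by
  obtain ⟨hr, hd⟩ := mark_eq_succ_iff.1 hw
  obtain ⟨p, hp⟩ := hr.symm.exists_walk_length_eq_dist
  rw [dist_comm, hd] at hp
  cases p with
  | nil => simp at hp
  | @cons _ v _ h q =>
    rw [Walk.length_cons, add_left_inj] at hp
    refine ⟨v, h.symm, mark_eq_succ_iff.2 ⟨q.reverse.reachable, le_antisymm ?_ ?_⟩⟩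
    · have := dist_le q.reverse
      rwa [Walk.length_reverse, hp] at this
    · obtain ⟨q', hq'⟩ := q.reverse.reachable.exists_walk_length_eq_dist
      have := dist_le (q'.concat h.symm)
      rw [Walk.length_concat] at this
      omega

theorem mark_le_card [Fintype V] : G.mark u v ≤ Fintype.card V := by
  rcases Nat.eq_zero_or_pos (G.mark u v) with h | h
  · omega
  · have hr := mark_pos_iff.1 h
    obtain ⟨p, hp, hl⟩ := hr.exists_path_of_dist
    have := hp.length_lt
    rw [mark_eq_succ_iff.2 ⟨hr, rfl⟩]
    omega

/-- A shortest path that avoids the edge, closed up by the edge, is a cycle. Its length is the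
distance plus one, hence the mark itself. -/
theorem exists_isCycle_of_mark (h : G.Adj u v)
    (hm : 0 < (G.deleteEdges {s(u, v)}).mark u v) :
    ∃ c : G.Walk v v, c.IsCycle ∧ c.length = (G.deleteEdges {s(u, v)}).mark u v := by
  have hr := mark_pos_iff.1 hm
  obtain ⟨p, hp, hl⟩ := hr.exists_path_of_dist
  refine ⟨Walk.cons h.symm (p.mapLe (G.deleteEdges_le _)), ?_, ?_⟩
  · rw [Walk.cons_isCycle_iff]
    refine ⟨hp.mapLe _, fun he => ?_⟩
    rw [Walk.edges_mapLe_eq_edges] at he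
    have := p.edges_subset_edgeSet he
    simp [Sym2.eq_swap] at this
  · rw [Walk.length_cons, Walk.length_map, hl, mark_eq_succ_iff.2 ⟨hr, rfl⟩]

/-- A cycle uses its first edge only once, so the rest of it is a walk in the graph without that
edge. -/
theorem mark_le_of_isCycle {h : G.Adj u v} {p : G.Walk v u} (hc : (Walk.cons h p).IsCycle) :
    0 < (G.deleteEdges {s(u, v)}).mark u v ∧
      (G.deleteEdges {s(u, v)}).mark u v ≤ (Walk.cons h p).length := by
  have hn := ((Walk.cons_isCycle_iff _ _).1 hc).2
  let q := (p.toDeleteEdge s(u, v) hn).reverse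
  have hq : q.length = p.length := by simp [q]
  refine ⟨mark_pos_iff.2 q.reachable, ?_⟩
  rw [mark_eq_succ_iff.2 ⟨q.reachable, rfl⟩, Walk.length_cons, ← hq]
  exact Nat.add_le_add_right (dist_le q) 1

theorem mark_comm : G.mark u v = G.mark v u := by
  unfold mark
  rw [dist_comm, reachable_comm]

end SimpleGraph

/-! ### The girth as a minimum over edges -/

namespace BTU

open Equiv SimpleGraph

variable {m : ℕ} {p : Fin 3 → Perm (Fin m)}

@[simp] theorem graph_adj_inl_inr {a y : Fin m} :
    (graph p).Adj (Sum.inl a) (Sum.inr y) ↔ ∃ i, p i a = y := by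
  simp [graph, eq_comm]

@[simp] theorem not_graph_adj_inl_inl {a b : Fin m} :
    ¬ (graph p).Adj (Sum.inl a) (Sum.inl b) := by
  simp [graph]

@[simp] theorem not_graph_adj_inr_inr {a b : Fin m} :
    ¬ (graph p).Adj (Sum.inr a) (Sum.inr b) := by
  simp [graph]

/-- The graph without the edge number `e` of row `a`. -/
def graphWithout (p : Fin 3 → Perm (Fin m)) (a : Fin m) (e : Fin 3) :
    SimpleGraph (Fin m ⊕ Fin m) :=
  (graph p).deleteEdges {s(Sum.inl a, Sum.inr (p e a))}

/-- The least length of a cycle through the edge number `e` of row `a`, or `0` if there is none. -/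
noncomputable def edgeGirth (p : Fin 3 → Perm (Fin m)) (a : Fin m) (e : Fin 3) : ℕ :=
  (graphWithout p a e).mark (Sum.inl a) (Sum.inr (p e a))

/-- By compatibility no other index yields the same edge in row `a`, so ignoring one index in the
search is the same as deleting the edge. -/
theorem graphWithout_adj_inl_inr (hp : Pairwise fun i i' => Compatible (p i) (p i'))
    {a x y : Fin m} {e : Fin 3} : (graphWithout p a e).Adj (Sum.inl x) (Sum.inr y) ↔
      ∃ i, ¬ (x = a ∧ i = e) ∧ p i x = y := by
  simp only [graphWithout, deleteEdges_adj, graph_adj_inl_inr, Set.mem_singleton_iff, Sym2.eq_iff,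
    Sum.inl.injEq, Sum.inr.injEq, reduceCtorEq, false_and, or_false]
  constructor
  · rintro ⟨⟨i, rfl⟩, h⟩
    refine ⟨i, ?_, rfl⟩
    rintro ⟨rfl, rfl⟩
    exact h ⟨rfl, rfl⟩
  · rintro ⟨i, h, rfl⟩
    refine ⟨⟨i, rfl⟩, ?_⟩
    rintro ⟨rfl, h'⟩
    exact hp (fun hie : i = e => h ⟨rfl, hie⟩) x h'

theorem egirth_le_edgeGirth {a : Fin m} {e : Fin 3} (h : 0 < edgeGirth p a e) :
    (graph p).egirth ≤ edgeGirth p a e := by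
  obtain ⟨c, hc, hl⟩ := exists_isCycle_of_mark (graph_adj_inl_inr.2 ⟨e, rfl⟩) h
  rw [edgeGirth, graphWithout, ← hl]
  exact egirth_le_length hc

theorem edgeGirth_le_length {u : Fin m ⊕ Fin m} {c : (graph p).Walk u u} (hc : c.IsCycle) :
    ∃ a e, 0 < edgeGirth p a e ∧ edgeGirth p a e ≤ c.length := by
  cases c with
  | nil => simp at hc
  | @cons _ v _ h q =>
    have key := mark_le_of_isCycle hc
    rcases u with a | y <;> rcases v with b | z
    · exact absurd h not_graph_adj_inl_inl
    · obtain ⟨e, rfl⟩ := graph_adj_inl_inr.1 h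
      exact ⟨a, e, key⟩
    · obtain ⟨e, rfl⟩ := graph_adj_inl_inr.1 h.symm
      rw [mark_comm, Sym2.eq_swap] at key
      exact ⟨b, e, key⟩
    · exact absurd h not_graph_adj_inr_inr

/-- The matchings `p 0` and `p 1` alternate along a cycle through row `a`. Starting at the far end
of the deleted edge, it visits the rows given by the powers of `σ` and uses no deleted edge until it
is back at `a`. -/
theorem edgeGirth_pos (hp : Pairwise fun i i' => Compatible (p i) (p i')) (a : Fin m) :
    0 < edgeGirth p a 0 := by
  have hadj := fun {x y} => graphWithout_adj_inl_inr hp (a := a) (x := x) (y := y) (e := 0)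
  set σ : Perm (Fin m) := (p 1)⁻¹ * p 0 with hσ
  have hσ1 : ∀ x, p 1 (σ x) = p 0 x := fun x => by simp [hσ]
  have key : ∀ t, (graphWithout p a 0).Reachable (Sum.inr (p 0 a)) (Sum.inl a) ∨
      (graphWithout p a 0).Reachable (Sum.inr (p 0 a)) (Sum.inl ((σ ^ (t + 1)) a)) := by
    intro t
    induction t with
    | zero =>
      refine Or.inr (Adj.reachable (hadj.2 ⟨1, by simp, ?_⟩).symm)
      simpa using hσ1 a
    | succ t ih =>
      rcases ih with ih | ih
      · exact Or.inl ih
      · rcases eq_or_ne ((σ ^ (t + 1)) a) a with h | h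
        · rw [h] at ih
          exact Or.inl ih
        · refine Or.inr ((ih.trans (Adj.reachable (hadj.2 ⟨0, fun h' => h h'.1, rfl⟩))).trans
            (Adj.reachable (hadj.2 ⟨1, by simp, ?_⟩).symm))
          rw [pow_succ' σ (t + 1), Perm.mul_apply, hσ1]
  have hpow : (σ ^ (orderOf σ - 1 + 1)) a = a := by
    rw [Nat.sub_add_cancel (orderOf_pos σ), pow_orderOf_eq_one, Perm.one_apply]
  refine mark_pos_iff.2 (Reachable.symm ?_)
  rcases key (orderOf σ - 1) with h | h
  · exact h
  · rwa [hpow] at h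

/-- A number that is the least positive length of a cycle through an edge is the girth. -/
theorem egirth_eq_of_isLeast (hm : 0 < m)
    (hp : Pairwise fun i i' => Compatible (p i) (p i')) {g : ℕ}
    (h1 : g ≠ 0 → ∃ a e, edgeGirth p a e = g)
    (h2 : ∀ a e, 0 < edgeGirth p a e → g ≠ 0 ∧ g ≤ edgeGirth p a e) :
    g ≠ 0 ∧ (graph p).egirth = g := by
  have hg : g ≠ 0 := (h2 _ _ (edgeGirth_pos hp ⟨0, hm⟩)).1
  obtain ⟨a, e, hae⟩ := h1 hg
  refine ⟨hg, le_antisymm ?_ ?_⟩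
  · rw [← hae]
    exact egirth_le_edgeGirth (by omega)
  · rw [le_egirth]
    intro u c hc
    obtain ⟨a, e, h, h'⟩ := edgeGirth_le_length hc
    exact_mod_cast ((h2 a e h).2.trans h')

/-- The column of the edge number `i` of row `x`. -/
def column (p : Fin 3 → Perm (Fin m)) (i x : ℕ) : ℕ :=
  if h : i < 3 ∧ x < m then p ⟨i, h.1⟩ ⟨x, h.2⟩ else 0

theorem column_eq (i : Fin 3) (x : Fin m) : column p i x = p i x := by
  simp [column]

theorem column_lt {i x : ℕ} (hi : i < 3) (hx : x < m) : column p i x < m := by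
  rw [column, dif_pos ⟨hi, hx⟩]
  exact Fin.is_lt _

/-- Extension of a function on `Fin m` by zero. -/
def extend {m : ℕ} (f : Fin m → ℕ) (x : ℕ) : ℕ := if h : x < m then f ⟨x, h⟩ else 0

@[simp] theorem extend_val {m : ℕ} (f : Fin m → ℕ) (x : Fin m) : extend f x = f x := by
  simp [extend]

/-- The properties are the usual ones of distances: adjacent vertices differ by at most one, and
every reachable vertex other than the source has a predecessor. Bipartiteness makes predecessors
switch sides. -/
theorem isMarking_mark (hp : Pairwise fun i i' => Compatible (p i) (p i')) (a : Fin m)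
    (e : Fin 3) : IsMarking m a (fun x y => ∃ i < 3, ¬ (x = a ∧ i = (e : ℕ)) ∧ column p i x = y)
      (extend fun x => (graphWithout p a e).mark (Sum.inl a) (Sum.inl x))
      (extend fun y => (graphWithout p a e).mark (Sum.inl a) (Sum.inr y)) := by
  have hE : ∀ x y : Fin m, (∃ i < 3, ¬ ((x : ℕ) = a ∧ i = (e : ℕ)) ∧ column p i x = y) ↔
      (graphWithout p a e).Adj (Sum.inl x) (Sum.inr y) := by
    intro x y
    rw [graphWithout_adj_inl_inr hp]
    constructor
    · rintro ⟨i, hi, h, h'⟩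
      refine ⟨⟨i, hi⟩, ?_, ?_⟩
      · rwa [Fin.ext_iff, Fin.ext_iff]
      · rw [Fin.ext_iff, ← h', ← column_eq]
    · rintro ⟨i, h, rfl⟩
      rw [Fin.ext_iff, Fin.ext_iff] at h
      exact ⟨i, i.2, h, column_eq i x⟩
  have hnadj : ∀ x y : Fin m, ¬ (graphWithout p a e).Adj (Sum.inl x) (Sum.inl y) :=
    fun x y h => not_graph_adj_inl_inl (deleteEdges_adj.1 h).1
  have hnadj' : ∀ x y : Fin m, ¬ (graphWithout p a e).Adj (Sum.inr x) (Sum.inr y) :=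
    fun x y h => not_graph_adj_inr_inr (deleteEdges_adj.1 h).1
  constructor
  · intro x hx
    lift x to Fin m using hx
    rw [extend_val, mark_eq_one_iff, Sum.inl.injEq, Fin.ext_iff]
  · intro y hy
    lift y to Fin m using hy
    rw [extend_val, Ne, mark_eq_one_iff]
    simp
  · intro y hy
    lift y to Fin m using hy
    rw [extend_val]
    refine mark_le_card.trans ?_
    simp
  · intro x hx y hy h t
    lift x to Fin m using hx
    lift y to Fin m using hy
    rw [extend_val, extend_val]
    exact mark_of_adj ((hE x y).1 h)
  · intro x hx y hy h t
    lift x to Fin m using hx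
    lift y to Fin m using hy
    rw [extend_val, extend_val]
    exact mark_of_adj ((hE x y).1 h).symm
  · intro y hy t
    lift y to Fin m using hy
    rw [extend_val]
    intro h
    obtain ⟨x | x, hadj, hx⟩ := exists_adj_of_mark h
    · exact ⟨x, x.2, (hE x y).2 hadj, by rw [extend_val, hx]⟩
    · exact absurd hadj (hnadj' _ _)
  · intro x hx t
    lift x to Fin m using hx
    rw [extend_val]
    intro h
    obtain ⟨y | y, hadj, hy⟩ := exists_adj_of_mark h
    · exact absurd hadj (hnadj _ _)
    · exact ⟨y, y.2, (hE x y).2 hadj.symm, by rw [extend_val, hy]⟩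

end BTU

/-! ### Girth computation, enumeration and the final answer -/

namespace BTU

open Equiv RAM RAM.Cmd Function SimpleGraph

variable {K : ℕ} {s : State Reg Arr}

theorem computeGirth_spec {m : ℕ} (hK : m + m < K) (h3K : 3 < K) (hm0 : 0 < m)
    {p : Fin 3 → Perm (Fin m)} (hp : Pairwise fun i i' => Compatible (p i) (p i'))
    (hm : s.reg .m = m) (hP : ∀ (i : Fin 3) (x : Fin m), s.arr .P (i * m + x) = p i x) :
    wp K computeGirth (fun s' => s'.reg .g ≠ 0 ∧ (graph p).egirth = s'.reg .g) s := by
  simp only [computeGirth, wp_block_cons, wp_assign, wp_block_singleton]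
  -- The value `g = 0` means that no cycle has been met so far, so minimality is claimed only
  -- together with `g ≠ 0`.
  refine wp_forLoop m (fun a s' => (s'.reg .g ≠ 0 → ∃ a e, edgeGirth p a e = s'.reg .g) ∧
    ∀ (a' : Fin m) e, (a' : ℕ) < a → 0 < edgeGirth p a' e →
      s'.reg .g ≠ 0 ∧ s'.reg .g ≤ edgeGirth p a' e) (by omega) rfl ?_ ?_ ?_ ?_
  · simp
  · intro s' hF
    simp [hF.reg .m rfl, hm]
  · intro a s₁ ha ha₁ hI₁ hF₁
    lift a to Fin m using ha
    rw [wp_block_cons, wp_assign, wp_block_singleton]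
    refine wp_forLoop 3 (fun e s' => s'.reg .off = e * m ∧
      (s'.reg .g ≠ 0 → ∃ a e, edgeGirth p a e = s'.reg .g) ∧
      ∀ (a' : Fin m) (e' : Fin 3), (a' : ℕ) < a ∨ a' = a ∧ (e' : ℕ) < e → 0 < edgeGirth p a' e' →
        s'.reg .g ≠ 0 ∧ s'.reg .g ≤ edgeGirth p a' e') h3K rfl ?_ ?_ ?_ ?_
    · simpa using hI₁
    · intro s' hF
      rfl
    · rintro e s₂ he he₂ ⟨hoff, hI₂, hI₂'⟩ hF₂
      lift e to Fin 3 using he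
      have hm₂ : s₂.reg .m = m := by simp [hF₂.reg .m rfl, hF₁.reg .m rfl, hm]
      have ha₂ : s₂.reg .a = a := by simp [hF₂.reg .a rfl, ha₁]
      have hP₂ : s₂.arr .P = s.arr .P := by simp [hF₂.arr .P rfl, hF₁.arr .P rfl]
      rw [wp_block_cons]
      refine wp_of_spec (search_spec hK h3K hm₂ ha₂ he₂ (col := column p) ?_
        (fun i hi x hx => column_lt hi hx) (isMarking_mark hp a e)) ?_
      · intro i hi x hx
        lift i to Fin 3 using hi
        lift x to Fin m using hx
        rw [hP₂, hP, column_eq]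
      intro s₃ hR hF₃
      have hm₃ : s₃.reg .m = m := by simp [hF₃.reg .m rfl, hm₂]
      have ha₃ : s₃.reg .a = a := by simp [hF₃.reg .a rfl, ha₂]
      have hoff₃ : s₃.reg .off = e * m := by simp [hF₃.reg .off rfl, hoff]
      have hg₃ : s₃.reg .g = s₂.reg .g := by simp [hF₃.reg .g rfl]
      have hy : s₃.arr .dR (s₃.arr .P (s₃.reg .off + s₃.reg .a)) = edgeGirth p a e := by
        rw [hF₃.arr .P rfl, hP₂, hoff₃, ha₃, hP, hR _ (Fin.is_lt _), extend_val, edgeGirth]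
      have hmul : ((e : ℕ) + 1) * m = e * m + m := by ring
      simp only [wp_block_cons, wp_block_singleton, wp_when, wp_assign, Expr.eval_not,
        Expr.eval_and, Expr.eval_lt, Expr.eval_reg, Expr.eval_add, Expr.eval_get,
        State.reg_setReg, reduceCtorEq, if_false, if_true, not_not, hm₃, hoff₃, hg₃, hmul,
        true_and]
      rw [← hoff₃, hy]
      have hcase : ∀ (a' : Fin m) (e' : Fin 3), (a' : ℕ) < a ∨ a' = a ∧ (e' : ℕ) < e + 1 →
          ((a' : ℕ) < a ∨ a' = a ∧ (e' : ℕ) < e) ∨ a' = a ∧ e' = e := by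
        intro a' e' h
        rw [Fin.ext_iff, Fin.ext_iff]
        rw [Fin.ext_iff] at h
        omega
      refine ⟨fun h => ⟨fun _ => ⟨a, e, rfl⟩, fun a' e' h' hpos => ?_⟩,
        fun h => ⟨hI₂, fun a' e' h' hpos => ?_⟩⟩
      · rcases hcase a' e' h' with h' | ⟨rfl, rfl⟩
        · have := hI₂' a' e' h' hpos
          omega
        · omega
      · rcases hcase a' e' h' with h' | ⟨rfl, rfl⟩
        · exact hI₂' a' e' h' hpos
        · omega
    · rintro s₂ - ⟨-, hI₂, hI₂'⟩ -
      refine ⟨hI₂, fun a' e' h => hI₂' a' e' ?_⟩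
      have := e'.2
      rw [Fin.ext_iff]
      omega
  · rintro s' - ⟨h1, h2⟩ -
    exact egirth_eq_of_isLeast hm0 hp h1 fun a e => h2 a e a.2

/-- A permutation of `Fin n` that consists of a single cycle of length `n`. -/
def IsFullCycle {n : ℕ} (q : Perm (Fin n)) : Prop :=
  ∃ hn : 0 < n, minimalPeriod q ⟨0, hn⟩ = n

/-- The shift `shift` and the permutation `out` have the largest girth, which is `best`, among the
pairs that satisfy `D`; if there are none, then `best` is `0`. -/
structure IsBest {m k n : ℕ} (h : k * n = m) (D : ℕ → Perm (Fin n) → Prop) (best shift : ℕ)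
    (out : ℕ → ℕ) : Prop where
  exists_eq : best ≠ 0 → ∃ q, D shift q ∧ (graph (family h shift q)).egirth = best ∧
    ∀ a < n, out a = natFun q a
  le : ∀ j q, D j q → best ≠ 0 ∧ (graph (family h j q)).egirth ≤ best

section

variable {m k n : ℕ} {h : k * n = m} {D D' : ℕ → Perm (Fin n) → Prop} {best shift : ℕ}
  {out : ℕ → ℕ}

theorem IsBest.congr (hb : IsBest h D best shift out) (hD : ∀ j q, D' j q ↔ D j q) :
    IsBest h D' best shift out := by
  have : D' = D := by
    ext j q
    exact hD j q
  rwa [this]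

theorem IsBest.insert_of_lt (hb : IsBest h D best shift out) {j g : ℕ} {q : Perm (Fin n)}
    {out' : ℕ → ℕ} (hD : ∀ j' q', D' j' q' ↔ D j' q' ∨ j' = j ∧ q' = q)
    (hg : (graph (family h j q)).egirth = g) (hlt : best < g)
    (hout : ∀ a < n, out' a = natFun q a) : IsBest h D' g j out' := by
  refine ⟨fun _ => ⟨q, (hD _ _).2 (Or.inr ⟨rfl, rfl⟩), hg, hout⟩, fun j' q' hd => ?_⟩
  refine ⟨by omega, ?_⟩
  rcases (hD _ _).1 hd with hd | ⟨rfl, rfl⟩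
  · exact (hb.le j' q' hd).2.trans (by exact_mod_cast hlt.le)
  · exact hg.le

theorem IsBest.insert_of_le (hb : IsBest h D best shift out) {j g : ℕ} {q : Perm (Fin n)}
    (hD : ∀ j' q', D' j' q' ↔ D j' q' ∨ j' = j ∧ q' = q)
    (hg : (graph (family h j q)).egirth = g) (hg0 : g ≠ 0) (hle : g ≤ best) :
    IsBest h D' best shift out := by
  refine ⟨fun h0 => ?_, fun j' q' hd => ?_⟩
  · obtain ⟨q', h1, h2⟩ := hb.exists_eq h0
    exact ⟨q', (hD _ _).2 (Or.inl h1), h2⟩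
  · rcases (hD _ _).1 hd with hd | ⟨rfl, rfl⟩
    · exact hb.le j' q' hd
    · exact ⟨by omega, hg.le.trans (by exact_mod_cast hle)⟩

end

theorem enumerate_spec {m b k j : ℕ} (hK : m + m < K) (h3K : 3 < K)
    (hfactK : (b * k).factorial < K) (hp : IsParam m b k) (hj : Admissible m b k j)
    (h : k * (b * k) = m) {D : ℕ → Perm (Fin (b * k)) → Prop}
    (hm : s.reg .m = m) (hk : s.reg .k = k) (hn : s.reg .n = b * k) (hjs : s.reg .j = j)
    (hfact : ∀ i ≤ b * k, s.arr .fact i = i.factorial)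
    (hbest : IsBest h D (s.reg .best) (s.reg .shift) (s.arr .out)) :
    wp K enumerate (fun s' => IsBest h (fun j' q => D j' q ∨ j' = j ∧ IsFullCycle q)
      (s'.reg .best) (s'.reg .shift) (s'.arr .out)) s := by
  obtain ⟨-, hk2, hn2, hnj, hjm⟩ := hj.bounds hp
  have hkm : k ≤ m := by nlinarith
  generalize hN : b * k = n at *
  -- The candidates examined before leaf `l` are the full cycles with smaller leaf number, added to
  -- those of earlier shifts.
  refine wp_forLoop n.factorial (fun l s' => IsBest h
    (fun j' q => D j' q ∨ j' = j ∧ IsFullCycle q ∧ leafBelow (natFun q) n 0 < l)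
    (s'.reg .best) (s'.reg .shift) (s'.arr .out)) hfactK rfl ?_ ?_ ?_ ?_
  · exact hbest.congr (by simp)
  · intro s' hF
    simp [hF.arr .fact rfl, hF.reg .n rfl, hn, hfact]
  · intro l s₁ hl hl₁ hI hF₁
    obtain ⟨q, hq⟩ := exists_leafBelow_eq hl
    have hm₁ : s₁.reg .m = m := by simp [hF₁.reg .m rfl, hm]
    have hk₁ : s₁.reg .k = k := by simp [hF₁.reg .k rfl, hk]
    have hn₁ : s₁.reg .n = n := by simp [hF₁.reg .n rfl, hn]
    have hj₁ : s₁.reg .j = j := by simp [hF₁.reg .j rfl, hjs]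
    have hfact₁ : ∀ i ≤ n, s₁.arr .fact i = i.factorial := by
      rw [hF₁.arr .fact rfl]
      exact hfact
    rw [wp_block_cons]
    refine wp_of_spec (walkToLeaf_spec (by omega) hn₁ hfact₁ (mapsTo_natFun q) (injOn_natFun q)
      (hl₁.trans hq.symm)) fun s₂ hq₂ hF₂ => ?_
    rw [wp_block_cons]
    refine wp_of_spec (cycleLength_spec (by omega) (show 0 < n by omega) q hq₂)
      fun s₃ hlen hF₃ => ?_
    have hm₃ : s₃.reg .m = m := by simp [hF₃.reg .m rfl, hF₂.reg .m rfl, hm₁]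
    have hk₃ : s₃.reg .k = k := by simp [hF₃.reg .k rfl, hF₂.reg .k rfl, hk₁]
    have hn₃ : s₃.reg .n = n := by simp [hF₃.reg .n rfl, hF₂.reg .n rfl, hn₁]
    have hj₃ : s₃.reg .j = j := by simp [hF₃.reg .j rfl, hF₂.reg .j rfl, hj₁]
    have hbest₃ : s₃.reg .best = s₁.reg .best := by simp [hF₃.reg .best rfl, hF₂.reg .best rfl]
    have hshift₃ : s₃.reg .shift = s₁.reg .shift := by
      simp [hF₃.reg .shift rfl, hF₂.reg .shift rfl]
    have hout₃ : s₃.arr .out = s₁.arr .out := by simp [hF₃.arr .out rfl, hF₂.arr .out rfl]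
    have hq₃ : ∀ i < n, s₃.arr .q i = natFun q i := by
      rw [hF₃.arr .q rfl]
      exact hq₂
    simp only [wp_block_singleton, wp_when, Expr.eval_eq, Expr.eval_reg, not_not, hlen, hn₃]
    have hinj : ∀ q', leafBelow (natFun q') n 0 = l → q' = q := fun q' hq' =>
      leafBelow_natFun_injective n (hq'.trans hq.symm)
    constructor
    · intro hfull
      have hD : ∀ j' q', (D j' q' ∨ j' = j ∧ IsFullCycle q' ∧ leafBelow (natFun q') n 0 < l + 1) ↔
          (D j' q' ∨ j' = j ∧ IsFullCycle q' ∧ leafBelow (natFun q') n 0 < l) ∨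
            j' = j ∧ q' = q := by
        intro j' q'
        constructor
        · rintro (hd | ⟨hd, hd', hd''⟩)
          · exact Or.inl (Or.inl hd)
          · rcases Nat.lt_succ_iff_lt_or_eq.1 hd'' with h' | h'
            · exact Or.inl (Or.inr ⟨hd, hd', h'⟩)
            · exact Or.inr ⟨hd, hinj q' h'⟩
        · rintro ((hd | ⟨hd, hd', hd''⟩) | ⟨hd, rfl⟩)
          · exact Or.inl hd
          · exact Or.inr ⟨hd, hd', by omega⟩
          · exact Or.inr ⟨hd, ⟨_, hfull⟩, by omega⟩
      rw [wp_block_cons]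
      refine wp_of_spec (buildBTU_spec (by omega) (by omega) (by omega) h (by omega) q hm₃ hk₃ hn₃
        hj₃ hq₃) fun s₄ hP hF₄ => ?_
      have hm₄ : s₄.reg .m = m := by simp [hF₄.reg .m rfl, hm₃]
      have hcomp : Pairwise fun i i' => Compatible (family h j q i) (family h j q i') := by
        subst hN
        exact compatible_family hp hj h q hfull
      rw [wp_block_cons]
      refine wp_of_spec (computeGirth_spec hK h3K (by omega) hcomp hm₄ hP) fun s₅ hg hF₅ => ?_
      have hn₅ : s₅.reg .n = n := by simp [hF₅.reg .n rfl, hF₄.reg .n rfl, hn₃]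
      have hj₅ : s₅.reg .j = j := by simp [hF₅.reg .j rfl, hF₄.reg .j rfl, hj₃]
      have hbest₅ : s₅.reg .best = s₁.reg .best := by
        simp [hF₅.reg .best rfl, hF₄.reg .best rfl, hbest₃]
      have hshift₅ : s₅.reg .shift = s₁.reg .shift := by
        simp [hF₅.reg .shift rfl, hF₄.reg .shift rfl, hshift₃]
      have hout₅ : s₅.arr .out = s₁.arr .out := by
        simp [hF₅.arr .out rfl, hF₄.arr .out rfl, hout₃]
      have hq₅ : ∀ i < n, s₅.arr .q i = natFun q i := by
        rw [hF₅.arr .q rfl, hF₄.arr .q rfl]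
        exact hq₃
      simp only [wp_block_singleton, wp_when, Expr.eval_lt, Expr.eval_reg, not_not]
      constructor
      · intro hlt
        rw [wp_block_cons, wp_assign, wp_block_cons, wp_assign, wp_block_singleton]
        refine wp_forLoop n (fun x s' => ∀ a < x, s'.arr .out a = natFun q a) (by omega) rfl
          (by simp) ?_ ?_ ?_
        · intro s' hF
          simp [hF.reg .n rfl, hn₅]
        · intro x s₆ hx hx₆ hI₆ hF₆
          have hq₆ : s₆.arr .q x = natFun q x := by
            rw [hF₆.arr .q rfl]
            exact hq₅ x hx
          simp only [wp_store, Expr.eval_reg, Expr.eval_get, State.arr_setReg, State.arr_setArr,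
            if_true, hx₆, hq₆, update_apply]
          intro a ha
          split_ifs with hax
          · rw [hax]
          · exact hI₆ a (by omega)
        · intro s₆ _ hI₆ hF₆
          have hbest₆ : s₆.reg .best = s₅.reg .g := by simp [hF₆.reg .best rfl]
          have hshift₆ : s₆.reg .shift = j := by simp [hF₆.reg .shift rfl, hj₅]
          simp only [State.reg_setReg, State.arr_setReg, reduceCtorEq, if_false, hbest₆, hshift₆]
          exact hI.insert_of_lt hD hg.2 (hbest₅ ▸ hlt) hI₆
      · intro hle
        simp only [State.reg_setReg, State.arr_setReg, reduceCtorEq, if_false, hbest₅, hshift₅,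
          hout₅]
        exact hI.insert_of_le hD hg.2 hg.1 (by omega)
    · intro hnot
      simp only [State.reg_setReg, State.arr_setReg, reduceCtorEq, if_false, hbest₃, hshift₃,
        hout₃]
      refine hI.congr fun j' q' => ?_
      refine or_congr_right (and_congr_right fun _ => and_congr_right fun hfull => ?_)
      refine ⟨fun h' => ?_, fun h' => by omega⟩
      by_contra hlt
      rw [hinj q' (by omega)] at hfull
      exact hnot hfull.2
  · rintro s' - hI -
    refine hI.congr fun j' q => ?_
    refine or_congr_right (and_congr_right fun _ => ?_)
    rw [iff_self_and]
    intro _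
    simpa using leafBelow_lt (mapsTo_natFun q) (injOn_natFun q) (Nat.zero_le n)

theorem algorithm_spec {m lo hi : ℕ} (hK : m + m + 3 < K) (hfactK : m.factorial < K)
    (hm : s.reg .m = m) (hlo : s.reg .lo = lo) (hhi : s.reg .hi = hi) :
    wp K algorithm (fun s' => IsParam m (s'.reg .b) (s'.reg .k) ∧
      ∀ h : s'.reg .k * (s'.reg .b * s'.reg .k) = m,
        IsBest h (fun j q => lo ≤ j ∧ j < hi ∧ Admissible m (s'.reg .b) (s'.reg .k) j ∧
          IsFullCycle q) (s'.reg .best) (s'.reg .shift) (s'.arr .out)) s := by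
  rw [algorithm, wp_block_cons]
  refine wp_of_spec (findParams_spec (by omega) hm) fun s₁ ⟨hp, hn₁⟩ hF₁ => ?_
  generalize hb₁ : s₁.reg .b = b at *
  generalize hk₁ : s₁.reg .k = k at *
  have h : k * (b * k) = m := by
    rw [hp.2.1]
    ring
  have hnm : b * k ≤ m := by
    rcases Nat.eq_zero_or_pos k with rfl | hk
    · simp
    · rw [← h]
      exact Nat.le_mul_of_pos_left _ hk
  rw [wp_block_cons]
  refine wp_of_spec (factorials_spec (by omega) hn₁) fun s₂ hfact₂ hF₂ => ?_
  have hm₂ : s₂.reg .m = m := by simp [hF₂.reg .m rfl, hF₁.reg .m rfl, hm]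
  have hlo₂ : s₂.reg .lo = lo := by simp [hF₂.reg .lo rfl, hF₁.reg .lo rfl, hlo]
  have hhi₂ : s₂.reg .hi = hi := by simp [hF₂.reg .hi rfl, hF₁.reg .hi rfl, hhi]
  have hb₂ : s₂.reg .b = b := by simp [hF₂.reg .b rfl, hb₁]
  have hk₂ : s₂.reg .k = k := by simp [hF₂.reg .k rfl, hk₁]
  have hn₂ : s₂.reg .n = b * k := by simp [hF₂.reg .n rfl, hn₁]
  simp only [wp_block_cons, wp_assign]
  rw [wp_block_singleton]
  refine wp_loop (fun s' => lo ≤ s'.reg .j ∧ IsBest h (fun j q => lo ≤ j ∧ j < hi ∧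
      j < s'.reg .j ∧ Admissible m b k j ∧ IsFullCycle q)
      (s'.reg .best) (s'.reg .shift) (s'.arr .out)) (fun s' => m - s'.reg .j) ?_ ?_ ?_ ?_
  · refine ⟨by simp [hlo₂], ?_, ?_⟩
    · simp
    · intro j q hd
      simp [hlo₂] at hd
      omega
  · omega
  · rintro s₃ ⟨hj₃, hI₃⟩ he hF₃
    have hm₃ : s₃.reg .m = m := by simp [hF₃.reg .m rfl, hm₂]
    have hhi₃ : s₃.reg .hi = hi := by simp [hF₃.reg .hi rfl, hhi₂]
    have hk₃ : s₃.reg .k = k := by simp [hF₃.reg .k rfl, hk₂]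
    have hn₃ : s₃.reg .n = b * k := by simp [hF₃.reg .n rfl, hn₂]
    have hfact₃ : ∀ i ≤ b * k, s₃.arr .fact i = i.factorial := by
      rw [hF₃.arr .fact rfl]
      exact hfact₂
    simp only [Expr.eval_and, Expr.eval_lt, Expr.eval_reg, hm₃, hhi₃, not_not] at he
    generalize hj : s₃.reg .j = j at *
    rw [wp_block_cons]
    refine wp_of_spec (testShift_spec (by omega) hm₃ hn₃ hj) fun s₄ hok hF₄ => ?_
    have hm₄ : s₄.reg .m = m := by simp [hF₄.reg .m rfl, hm₃]
    have hk₄ : s₄.reg .k = k := by simp [hF₄.reg .k rfl, hk₃]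
    have hn₄ : s₄.reg .n = b * k := by simp [hF₄.reg .n rfl, hn₃]
    have hj₄ : s₄.reg .j = j := by simp [hF₄.reg .j rfl, hj]
    have hfact₄ : ∀ i ≤ b * k, s₄.arr .fact i = i.factorial := by
      rw [hF₄.arr .fact rfl]
      exact hfact₃
    have hbest₄ : s₄.reg .best = s₃.reg .best := by simp [hF₄.reg .best rfl]
    have hshift₄ : s₄.reg .shift = s₃.reg .shift := by simp [hF₄.reg .shift rfl]
    have hout₄ : s₄.arr .out = s₃.arr .out := by simp [hF₄.arr .out rfl]
    rw [wp_block_cons, wp_when]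
    refine ⟨fun h' => ?_, fun h' => ?_⟩
    · have hadm : Admissible m b k j := hok.1 h'
      refine wp_of_spec (enumerate_spec (by omega) (by omega)
        ((Nat.factorial_le hnm).trans_lt hfactK) hp hadm h hm₄ hk₄ hn₄ hj₄ hfact₄
        (by rw [hbest₄, hshift₄, hout₄]; exact hI₃)) fun s₅ hI₅ hF₅ => ?_
      have hj₅ : s₅.reg .j = j := by simp [hF₅.reg .j rfl, hj₄]
      simp only [wp_block_singleton, wp_assign, Expr.eval_add, Expr.eval_reg, Expr.eval_lit, hj₅,
        State.reg_setReg, State.arr_setReg, reduceCtorEq, if_false, if_true]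
      refine ⟨⟨by omega, hI₅.congr fun j' q => ?_⟩, by omega⟩
      constructor
      · rintro ⟨h1, h2, h3, h4⟩
        rcases Nat.lt_succ_iff_lt_or_eq.1 h3 with h3 | rfl
        · exact Or.inl ⟨h1, h2, h3, h4⟩
        · exact Or.inr ⟨rfl, h4.2⟩
      · rintro (⟨h1, h2, h3, h4⟩ | ⟨rfl, h4⟩)
        · exact ⟨h1, h2, by omega, h4⟩
        · exact ⟨hj₃, he.1, by omega, hadm, h4⟩
    · have hadm : ¬ Admissible m b k j := fun h'' => hok.2 h'' h'
      simp only [wp_block_singleton, wp_assign, Expr.eval_add, Expr.eval_reg, Expr.eval_lit, hj₄,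
        State.reg_setReg, State.arr_setReg, reduceCtorEq, if_false, if_true, hbest₄, hshift₄,
        hout₄]
      refine ⟨⟨by omega, hI₃.congr fun j' q => ?_⟩, by omega⟩
      constructor
      · rintro ⟨h1, h2, h3, h4⟩
        rcases Nat.lt_succ_iff_lt_or_eq.1 h3 with h3 | rfl
        · exact ⟨h1, h2, h3, h4⟩
        · exact absurd h4.1 hadm
      · rintro ⟨h1, h2, h3, h4⟩
        exact ⟨h1, h2, by omega, h4⟩
  · rintro s₃ ⟨-, hI₃⟩ he hF₃
    have hm₃ : s₃.reg .m = m := by simp [hF₃.reg .m rfl, hm₂]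
    have hhi₃ : s₃.reg .hi = hi := by simp [hF₃.reg .hi rfl, hhi₂]
    have hb₃ : s₃.reg .b = b := by simp [hF₃.reg .b rfl, hb₂]
    have hk₃ : s₃.reg .k = k := by simp [hF₃.reg .k rfl, hk₂]
    simp only [Expr.eval_and, Expr.eval_lt, Expr.eval_reg, hm₃, hhi₃, not_not] at he
    rw [hb₃, hk₃]
    refine ⟨hp, fun _ => hI₃.congr fun j q => ?_⟩
    constructor
    · rintro ⟨h1, h2, h3, h4⟩
      -- Stopping at `m` loses nothing even if `hi` is larger, as admissible shifts are below `m`.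
      have := h3.bounds hp
      exact ⟨h1, h2, by omega, h3, h4⟩
    · rintro ⟨h1, h2, h3, h4⟩
      exact ⟨h1, h2, h4⟩

theorem correct_of_isBest {i : Input} (hp : IsParam i.m (s.reg .b) (s.reg .k))
    (hbest : ∀ h : s.reg .k * (s.reg .b * s.reg .k) = i.m,
      IsBest h (fun j q => i.lo ≤ j ∧ j < i.hi ∧ Admissible i.m (s.reg .b) (s.reg .k) j ∧
        IsFullCycle q) (s.reg .best) (s.reg .shift) (s.arr .out)) : Correct i s := by
  have h : s.reg .k * (s.reg .b * s.reg .k) = i.m := by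
    rw [hp.2.1]
    ring
  replace hbest := hbest h
  refine ⟨hp, ?_, ?_⟩
  · rintro ⟨j, hlo, hhi, hadm⟩
    have hpos : 0 < s.reg .b * s.reg .k := by
      have := hadm.bounds hp
      omega
    -- The rotation is a full cycle, so an admissible shift always has a candidate and `best` cannot
    -- be `0`.
    have h0 := (hbest.le j (finRotate _) ⟨hlo, hhi, hadm, hpos, minimalPeriod_finRotate _⟩).1
    obtain ⟨q, ⟨hlo', hhi', hadm', hfull⟩, hg, hout⟩ := hbest.exists_eq h0
    refine ⟨⟨hlo', hhi', hadm'⟩, family h (s.reg .shift) q,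
      family_mem_Z hp hadm' h q hfull.2, rfl,
      ⟨h, q, rfl, fun a => by rw [hout a a.2, natFun_val]⟩, ?_, hg.symm⟩
    rintro p' hp' j' ⟨hlo'', hhi'', hadm''⟩ hj'
    obtain ⟨q', hq', rfl⟩ := eq_family_of_mem_Z hp hadm'' h hp' hj'
    rw [hg]
    exact (hbest.le j' q' ⟨hlo'', hhi'', hadm'', hpos, hq'⟩).2
  · intro hne
    by_contra h0
    obtain ⟨q, ⟨hlo', hhi', hadm', -⟩, -⟩ := hbest.exists_eq h0
    exact hne ⟨_, hlo', hhi', hadm'⟩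

end BTU

/-- The size of an input is `m`. -/
theorem corollary3 :
    RAM.InEXPTIME BTU.algorithm BTU.Input.state BTU.Input.m BTU.Correct := by
  -- The exponent of `K = 2 ^ (m ^ 2 + 4)` times the weight of the program. Here `2 ^ (m ^ 2)`
  -- dominates `m!`, and the factor `16` leaves room for `2 * m + 3`.
  refine ⟨(Polynomial.X ^ 2 + 4) * Polynomial.C BTU.algorithm.weight, fun i => ?_⟩
  have h1 : i.m < 2 ^ (i.m ^ 2) :=
    (Nat.le_self_pow two_ne_zero i.m).trans_lt Nat.lt_two_pow_self
  have h2 : i.m.factorial ≤ 2 ^ (i.m ^ 2) := by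
    calc i.m.factorial ≤ i.m ^ i.m := Nat.factorial_le_pow i.m
      _ ≤ (2 ^ i.m) ^ i.m := Nat.pow_le_pow_left Nat.lt_two_pow_self.le _
      _ = 2 ^ (i.m ^ 2) := by rw [← pow_mul, pow_two]
  have hK : 2 ^ (i.m ^ 2 + 4) = 2 ^ (i.m ^ 2) * 16 := by rw [pow_add]; norm_num
  obtain ⟨t, s', hexec, ht, hp, hbest⟩ := RAM.exists_exec_of_wp (by omega)
    (BTU.algorithm_spec (K := 2 ^ (i.m ^ 2 + 4)) (s := i.state) (m := i.m) (lo := i.lo)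
      (hi := i.hi) (by omega) (by omega) rfl rfl rfl)
  refine ⟨t, s', hexec, ?_, BTU.correct_of_isBest hp hbest⟩
  rw [← pow_mul] at ht
  simpa using ht
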